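/- A planar tree is a rooted, locally finite tree $T$ whose vertices at height (distance from the root) $r$ form a finite ordered set $D_r=D_r(T)$, with order-preserving parent maps $D_r\to D_{r-1}$, and such that $|D_0|=|D_1|=1$; isomorphic planar trees are identified. Its size $|T|$ is its number of edges, its height $h(T)$ (for finite $T$) is the largest $r$ with $D_r\neq\emptyset$, and for $r\ge 1$ the ball $B_r(T)$ is the subtree spanned by the vertices of height at most $r$, so that $|B_r(T)|=\sum_{s=1}^r|D_s(T)|$. The set $\mathcal T$ of all finite and infinite planar trees carries the metric $\mathrm{dist}(T,T')=\inf\{1/r \mid r\ge 1,\ B_r(T)=B_r(T')\}$ and its Borel $\sigma$-algebra. For $\mu\in\mathbb R$ and $N\ge 1$ let $\nu_N^{(\mu)}$ be the probability measure on $\mathcal T$ supported on the trees of size $N$ with $\nu_N^{(\mu)}(\{T\})=e^{-\mu h(T)}/Z_N^{(\mu)}$, where $Z_N^{(\mu)}=\sum_{|T|=N}e^{-\mu h(T)}$. Let $\mu<0$. Then $\nu^{(\mu)}_N$ converges weakly, as $N\to\infty$, to a Borel probability measure $\nu^{(\mu)}$ on $\mathcal T$ (the local limit), and the following holds. There are constants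 $C_1,C_2>0$ (depending only on $\mu$) and for $\nu^{(\mu)}$-a.e. tree $T$ a number $r_0(T)\in\mathbb N$ such that $$1\le |D_r(T)|\le C_1\ln r\qquad\text{and}\qquad r\le |B_r(T)|\le C_2\, r\ln r\qquad\text{for all } r\ge r_0(T).$$ Consequently the limit $d_h=\lim_{r\to\infty}\frac{\ln|B_r(T)|}{\ln r}$ exists and equals $1$ for $\nu^{(\mu)}$-a.e. tree $T$. -/

import Mathlib

open Filter Topology MeasureTheory
open scoped ENNReal BoundedContinuousFunction

/-- A (rooted, locally finite) planar tree whose root has exactly one offspring.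
The vertices at height `r` form a finite ordered set `D r`, which is represented by its canonical
copy `{0, …, |D r| - 1}` (left to right), so that two trees are isomorphic as planar trees if and
only if they are equal.  The list `parents r` is the order preserving parent map
`D (r + 1) → D r`: its `i`-th entry is the position in `D r` of the parent of the `i`-th vertex of
`D (r + 1)`.  In particular `D (r + 1)` has `(parents r).length` elements, and `D 0`, `D 1` are
one-point sets. -/
@[ext]
structure PlanarTree where
  parents : ℕ → List ℕ
  parents_zero : parents 0 = [0]
  parents_mono : ∀ r, (parents r).Pairwise (· ≤ ·)
  parents_lt : ∀ r, ∀ p ∈ parents (r + 1), p < (parents r).length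

namespace PlanarTree

/-- The number `|D_r(T)|` of vertices at height `r`. -/
def width (T : PlanarTree) : ℕ → ℕ
  | 0 => 1
  | r + 1 => (T.parents r).length

/-- The edges of `T`: the pair `(s, i)` stands for the edge which joins the `i`-th vertex at height
`s + 1` to its parent. -/
def edges (T : PlanarTree) : Set (ℕ × ℕ) := {e | e.2 < T.width (e.1 + 1)}

/-- The size `|T|`, i.e. the number of edges, possibly infinite. -/
noncomputable def size (T : PlanarTree) : ℕ∞ := T.edges.encard

/-- The height of a finite tree: the largest `r` for which there is a vertex at height `r`.
(It is used for finite trees only.) -/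
noncomputable def height (T : PlanarTree) : ℕ := sSup {r | T.width r ≠ 0}

/-- The ball `B_r(T)`, `r ≥ 1`: the subtree of `T` spanned by the vertices of height at most `r`.
(Trees have at least one edge; for `r = 0` this is `B_1(T)`.) -/
def ball (T : PlanarTree) (r : ℕ) : PlanarTree where
  parents s := if s < r ∨ s = 0 then T.parents s else []
  parents_zero := by simp [T.parents_zero]
  parents_mono s := by
    split_ifs
    · exact T.parents_mono s
    · exact List.Pairwise.nil
  parents_lt s p hp := by
    by_cases h : s + 1 < r
    · have h' : s < r := by omega
      simp only [h, h', true_or, if_true] at hp ⊢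
      exact T.parents_lt s p hp
    · simp [h] at hp

/-- The volume `|B_r(T)|`, i.e. the number of edges of the (finite) tree `B_r(T)`. -/
noncomputable def ballVolume (T : PlanarTree) (r : ℕ) : ℕ := (T.ball r).edges.ncard

theorem ball_eq_iff {T T' : PlanarTree} {r : ℕ} :
    T.ball r = T'.ball r ↔ ∀ s < r, T.parents s = T'.parents s := by
  constructor
  · intro h s hs
    have := congrFun (congrArg PlanarTree.parents h) s
    simpa [ball, hs] using this
  · intro h
    ext1
    funext s
    by_cases hs : s < r
    · simp [ball, hs, h s hs]
    · rcases Nat.eq_zero_or_pos s with rfl | h0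
      · simp [ball, T.parents_zero, T'.parents_zero]
      · have : s ≠ 0 := by omega
        simp [ball, hs, this]

/-- The numbers `1 / r`, `r ≥ 1`, for which `B_r(T) = B_r(T')`. -/
def agreement (T T' : PlanarTree) : Set ℝ :=
  {x | ∃ r : ℕ, 1 ≤ r ∧ T.ball r = T'.ball r ∧ x = 1 / (r : ℝ)}

/-- `dist(T, T') = inf {1 / r | r ≥ 1, B_r(T) = B_r(T')}`. -/
noncomputable instance : Dist PlanarTree := ⟨fun T T' => sInf (agreement T T')⟩

theorem dist_def (T T' : PlanarTree) : dist T T' = sInf (agreement T T') := rfl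

theorem agreement_nonempty (T T' : PlanarTree) : (agreement T T').Nonempty := by
  refine ⟨1, 1, le_rfl, ball_eq_iff.2 ?_, by simp⟩
  intro s hs
  obtain rfl : s = 0 := by omega
  rw [T.parents_zero, T'.parents_zero]

theorem agreement_nonneg (T T' : PlanarTree) : ∀ x ∈ agreement T T', 0 ≤ x := by
  rintro x ⟨r, -, -, rfl⟩
  positivity

theorem agreement_bddBelow (T T' : PlanarTree) : BddBelow (agreement T T') :=
  ⟨0, fun x hx => agreement_nonneg T T' x hx⟩

theorem exists_of_dist_lt {T T' : PlanarTree} {a : ℝ} (h : dist T T' < a) :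
    ∃ r : ℕ, 1 ≤ r ∧ 1 / (r : ℝ) < a ∧ T.ball r = T'.ball r := by
  obtain ⟨x, ⟨r, hr, hb, rfl⟩, hx⟩ := exists_lt_of_csInf_lt (agreement_nonempty T T') h
  exact ⟨r, hr, hx, hb⟩

theorem dist_le_of_ball_eq {T T' : PlanarTree} {r : ℕ} (hr : 1 ≤ r) (h : T.ball r = T'.ball r) :
    dist T T' ≤ 1 / (r : ℝ) :=
  csInf_le (agreement_bddBelow T T') ⟨r, hr, h, rfl⟩

theorem dist_nonneg' (T T' : PlanarTree) : 0 ≤ dist T T' :=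
  le_csInf (agreement_nonempty T T') (agreement_nonneg T T')

noncomputable instance : MetricSpace PlanarTree where
  dist_self T := by
    refine le_antisymm (le_of_forall_pos_le_add fun ε hε => ?_) (dist_nonneg' T T)
    obtain ⟨n, hn⟩ := exists_nat_one_div_lt hε
    have := dist_le_of_ball_eq (T := T) (T' := T) (r := n + 1) (by omega) rfl
    push_cast at this
    linarith
  dist_comm T T' := by
    simp only [dist_def, agreement, eq_comm]
  dist_triangle T₁ T₂ T₃ := by
    refine le_of_forall_pos_le_add fun ε hε => ?_
    obtain ⟨r, hr, hra, hrb⟩ := exists_of_dist_lt (lt_add_of_pos_right (dist T₁ T₂) hε)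
    obtain ⟨s, hs, hsa, hsb⟩ := exists_of_dist_lt (lt_add_of_pos_right (dist T₂ T₃) hε)
    have h12 := dist_nonneg' T₁ T₂
    have h23 := dist_nonneg' T₂ T₃
    rw [ball_eq_iff] at hrb hsb
    rcases le_total r s with h | h
    · have := dist_le_of_ball_eq (T := T₁) (T' := T₃) hr (ball_eq_iff.2 fun i hi =>
        (hrb i hi).trans (hsb i (by omega)))
      linarith
    · have := dist_le_of_ball_eq (T := T₁) (T' := T₃) hs (ball_eq_iff.2 fun i hi =>
        (hrb i (by omega)).trans (hsb i hi))
      linarith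
  eq_of_dist_eq_zero := by
    intro T T' h
    ext1
    funext s
    have hpos : dist T T' < 1 / ((s : ℝ) + 1) := by
      have : dist T T' = 0 := h
      rw [this]
      positivity
    obtain ⟨r, hr, hrs, hb⟩ := exists_of_dist_lt hpos
    have hr0 : (0 : ℝ) < r := by exact_mod_cast hr
    have hlt : (s : ℝ) + 1 < r := (one_div_lt_one_div hr0 (by positivity)).1 hrs
    have hlt' : s + 1 < r := by exact_mod_cast hlt
    exact ball_eq_iff.1 hb s (by omega)

noncomputable instance : MeasurableSpace PlanarTree := borel PlanarTree

instance : BorelSpace PlanarTree := ⟨rfl⟩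

/-- The set of planar trees with exactly `N` edges. -/
def treesOfSize (N : ℕ) : Set PlanarTree := {T | T.size = N}

/-- The weight `exp (-μ h(T))` of a finite tree. -/
noncomputable def weight (μ : ℝ) (T : PlanarTree) : ℝ≥0∞ :=
  ENNReal.ofReal (Real.exp (-μ * T.height))

/-- The finite size partition function: the sum of `exp (-μ h(T))` over all trees `T` of
size `N`. -/
noncomputable def partitionFunction (μ : ℝ) (N : ℕ) : ℝ≥0∞ :=
  ∑' T : treesOfSize N, weight μ T

/-- The probability measure on trees of size `N ≥ 1` that gives mass `exp (-μ h(T)) / Z_N` to each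
tree `T` of size `N`, as a Borel measure on the space of all trees. -/
noncomputable def finiteSizeMeasure (μ : ℝ) (N : ℕ) : Measure PlanarTree :=
  Measure.sum fun T : treesOfSize N => (weight μ T / partitionFunction μ N) • Measure.dirac T.1

/-- `ν` is the local limit of the finite size measures: a Borel probability measure to which they
converge weakly as `N → ∞`. -/
def IsLocalLimit (μ : ℝ) (ν : Measure PlanarTree) : Prop :=
  IsProbabilityMeasure ν ∧
    ∀ F : PlanarTree →ᵇ ℝ,
      Tendsto (fun N : ℕ => ∫ T, F T ∂(finiteSizeMeasure μ N)) atTop (𝓝 (∫ T, F T ∂ν))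

/-- The tree `T` has volume growth exponent (Hausdorff dimension) `d`: the limit of
`ln |B_r(T)| / ln r` as `r → ∞` exists and equals `d`. -/
def HasHausdorffDim (T : PlanarTree) (d : ℝ) : Prop :=
  Tendsto (fun r : ℕ => Real.log (T.ballVolume r) / Real.log r) atTop (𝓝 d)

end PlanarTree

/-! Put `a = exp (-μ) > 1`, so that a finite tree carries the weight `a ^ height`. The local limit
is a Markov tree: the list of children of each generation is drawn by a kernel that depends only on
the number `K` of parents. The theorem is then a tail bound for the width chain.

Existence of the limit. A cylinder fixes the first generations, and its weight is governed by
`extWeight a K n`, the weighted number of ways to hang `n` further edges below a top level of `K`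
vertices. With `x = l / (1 + l) ^ 2`, the generating function of the descendants of one vertex
within relative height less than `m` is the explicit `Y_m = forestGF l m`, hence `extWeight` has
generating function `∑ a ^ m (Y_{m+1} ^ K - Y_m ^ K)`. Since `Y_m` approaches `1 + l` like `l ^ m`,
the linear part of the summand is a geometric series of ratio `a l`, while the rest is of order `(a
l ^ 2) ^ m`. So the dominant singularity is a simple pole at `l = 1 / a`, that is at `g = a / (1 +
a) ^ 2`, which is smaller than `1 / 4` because `a > 1`. Therefore `extWeight a K n * g ^ (n + 1)`
tends to a constant times `K (1 + 1 / a) ^ K` (`tendsto_extWeight`), and cylinder probabilities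
converge.

The limit. The limiting cylinder probabilities are those of the Doob transform by `harm a K = K (1 +
1 / a) ^ (K - 1)`: a given list of `L` children of `K` vertices has probability `a g ^ L harm L /
harm K`. This is realized as the image of a product measure (`limitMeasure`), and convergence on
cylinders gives weak convergence. As `harm a 0 = 0`, the limit tree almost surely never dies.

Growth. The weights `n a ^ (-(n - 1))` are invariant under the width chain (`hasSum_stationary`) and
dominate its initial law, a point mass at 1, hence dominate its law at every height. Widths thus
have uniformly exponential tails, and Borel–Cantelli gives a width of order at most `log r`. Summing
over heights bounds the volume by a multiple of `r log r`; the lower bound is survival. -/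

namespace PlanarTree

/-! ### Counting extensions of a tree -/

/-- The number of ways to extend a tree with `K` vertices at its top level by `n` edges such that
the height increases by exactly `m`. -/
noncomputable def extCount : ℕ → ℕ → ℕ → ℝ≥0∞
  | 0, _, n => if n = 0 then 1 else 0
  | m + 1, K, n => ∑ p ∈ Finset.HasAntidiagonal.antidiagonal n,
      if p.1 = 0 then 0 else (K.multichoose p.1 : ℝ≥0∞) * extCount m p.1 p.2

/-- The extensions by `n` edges of a tree with `K` vertices at its top level, counted with weight
`a` per additional level. -/
noncomputable def extWeight (a : ℝ≥0∞) (K n : ℕ) : ℝ≥0∞ := ∑' m, a ^ m * extCount m K n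

theorem extWeight_eq (a : ℝ≥0∞) (K n : ℕ) :
    extWeight a K n = (if n = 0 then 1 else 0) + a * ∑ p ∈ Finset.HasAntidiagonal.antidiagonal n,
      if p.1 = 0 then 0 else (K.multichoose p.1 : ℝ≥0∞) * extWeight a p.1 p.2 := by
  rw [extWeight, tsum_eq_zero_add' ENNReal.summable]
  congr 1
  · simp [extCount]
  · simp only [extCount, extWeight, pow_succ', mul_assoc, ENNReal.tsum_mul_left]
    congr 1
    simp only [Finset.mul_sum]
    rw [Summable.tsum_finsetSum fun _ _ => ENNReal.summable]
    refine Finset.sum_congr rfl fun p _ => ?_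
    split_ifs
    · simp
    · rw [← ENNReal.tsum_mul_left]
      exact tsum_congr fun m => by ring

theorem tsum_sum_antidiagonal (F : ℕ → ℕ → ℝ≥0∞) :
    ∑' n, ∑ p ∈ Finset.HasAntidiagonal.antidiagonal n, F p.1 p.2 = ∑' i, ∑' j, F i j := by
  rw [← ENNReal.tsum_prod, ← Finset.HasAntidiagonal.sigmaAntidiagonalEquivProd.tsum_eq,
    ENNReal.tsum_sigma']
  refine tsum_congr fun n => ?_
  rw [tsum_fintype, ← Finset.sum_attach]
  rfl

theorem hasSum_multichoose_mul_pow (K : ℕ) {z : ℝ} (h0 : 0 ≤ z) (h1 : z < 1) :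
    HasSum (fun L => (K.multichoose L : ℝ) * z ^ L) ((1 - z)⁻¹ ^ K) := by
  cases K with
  | zero =>
    have := hasSum_single (f := fun L => ((0 : ℕ).multichoose L : ℝ) * z ^ L) 0 (by
      rintro (_ | L) hL
      · exact absurd rfl hL
      · simp)
    simpa using this
  | succ K =>
    have hz : ‖z‖ < 1 := by rwa [Real.norm_of_nonneg h0]
    have := hasSum_choose_mul_geometric_of_norm_lt_one K hz
    rw [one_div, ← inv_pow] at this
    convert! this using 4 with L
    rw [Nat.multichoose_eq, show K + 1 + L - 1 = L + K by omega, ← Nat.choose_symm_add]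

/-- The generating function, in the variable `x = l / (1 + l) ^ 2`, of the number of ways to attach
descendants of relative height less than `m` to a vertex. -/
noncomputable def forestGF {𝕜 : Type*} [Field 𝕜] (l : 𝕜) (m : ℕ) : 𝕜 :=
  (1 + l) * (1 - l ^ m) / (1 - l ^ (m + 1))

section real

variable {l : ℝ}

theorem forestGF_mono (h0 : 0 < l) (h1 : l < 1) (m : ℕ) : forestGF l m ≤ forestGF l (m + 1) := by
  have h2 : l ^ (m + 1) < 1 := pow_lt_one₀ h0.le h1 (by omega)
  have h3 : l ^ (m + 1 + 1) < 1 := pow_lt_one₀ h0.le h1 (by omega)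
  rw [forestGF, forestGF, div_le_div_iff₀ (by linarith) (by linarith), mul_assoc, mul_assoc]
  refine mul_le_mul_of_nonneg_left ?_ (by linarith)
  have : (1 - l ^ (m + 1)) * (1 - l ^ (m + 1)) - (1 - l ^ m) * (1 - l ^ (m + 1 + 1))
    = l ^ m * (1 - l) ^ 2 := by ring
  have : 0 ≤ l ^ m * (1 - l) ^ 2 := by positivity
  linarith

theorem forestGF_nonneg (h0 : 0 < l) (h1 : l < 1) (m : ℕ) : 0 ≤ forestGF l m := by
  have h2 : l ^ (m + 1) < 1 := pow_lt_one₀ h0.le h1 (by omega)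
  have h3 : l ^ m ≤ 1 := pow_le_one₀ h0.le h1.le
  exact div_nonneg (mul_nonneg (by linarith) (by linarith)) (by linarith)

/-- This is the recursion `Y_{m+1} = 1 / (1 - x Y_m)`: the descendants of a vertex form a finite
sequence of children, each with descendants one level shallower. -/
theorem one_sub_mul_forestGF (h0 : 0 < l) (h1 : l < 1) (m : ℕ) :
    1 - l / (1 + l) ^ 2 * forestGF l m = (forestGF l (m + 1))⁻¹ := by
  have h2 : l ^ (m + 1) < 1 := pow_lt_one₀ h0.le h1 (by omega)
  have h3 : l ^ (m + 1 + 1) < 1 := pow_lt_one₀ h0.le h1 (by omega)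
  have h4 : 1 - l ^ (m + 1) ≠ 0 := by linarith
  have h5 : 1 - l ^ (m + 1 + 1) ≠ 0 := by linarith
  have h6 : 1 + l ≠ 0 := by linarith
  rw [forestGF, forestGF, inv_div]
  field_simp
  ring

theorem forestGF_succ_pos (h0 : 0 < l) (h1 : l < 1) (m : ℕ) : 0 < forestGF l (m + 1) := by
  have h2 : l ^ (m + 1) < 1 := pow_lt_one₀ h0.le h1 (by omega)
  have h3 : l ^ (m + 1 + 1) < 1 := pow_lt_one₀ h0.le h1 (by omega)
  exact div_pos (mul_pos (by linarith) (by linarith)) (by linarith)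

theorem hasSum_multichoose_forestGF (h0 : 0 < l) (h1 : l < 1) (K m : ℕ) :
    HasSum (fun L => (K.multichoose L : ℝ) * (l / (1 + l) ^ 2 * forestGF l m) ^ L)
      (forestGF l (m + 1) ^ K) := by
  have h := one_sub_mul_forestGF h0 h1 m
  have hp := inv_pos.2 (forestGF_succ_pos h0 h1 m)
  have := hasSum_multichoose_mul_pow K (z := l / (1 + l) ^ 2 * forestGF l m)
    (mul_nonneg (by positivity) (forestGF_nonneg h0 h1 m)) (by linarith)
  rwa [h, inv_inv] at this

/-- `Y_{m+1} ^ K` counts the extensions by at most `m` levels, so the difference counts those by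
exactly `m`. The induction sums over the size of the next generation. For `K = 0` the identity fails
at `m = 0`, where `Y_0 ^ K` has to vanish. -/
theorem tsum_extCount (h0 : 0 < l) (h1 : l < 1) (m : ℕ) : ∀ K ≠ 0,
    ∑' n, extCount m K n * ENNReal.ofReal (l / (1 + l) ^ 2) ^ n =
      ENNReal.ofReal (forestGF l (m + 1) ^ K - forestGF l m ^ K) := by
  induction m with
  | zero =>
    intro K hK
    rw [tsum_eq_single 0 (by intro n hn; simp [extCount, hn])]
    have : 1 - l ^ 2 ≠ 0 := by nlinarith
    have h : forestGF l 1 = 1 := by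
      rw [forestGF, div_eq_one_iff_eq (by simpa using this)]; ring
    rw [h]
    simp [extCount, forestGF, hK]
  | succ m ih =>
    intro K hK
    set x := l / (1 + l) ^ 2 with hx
    have hx0 : 0 ≤ x := by positivity
    have key : ∀ n, extCount (m + 1) K n * ENNReal.ofReal x ^ n =
        ∑ p ∈ Finset.HasAntidiagonal.antidiagonal n, (fun i j => (if i = 0 then 0 else
          (K.multichoose i : ℝ≥0∞) * ENNReal.ofReal x ^ i *
            (extCount m i j * ENNReal.ofReal x ^ j))) p.1 p.2 := by
      intro n
      rw [extCount, Finset.sum_mul]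
      refine Finset.sum_congr rfl fun p hp => ?_
      rw [Finset.HasAntidiagonal.mem_antidiagonal] at hp
      by_cases h : p.1 = 0
      · simp [h]
      · simp only [h, if_false, ← hp, pow_add]; ring
    refine (tsum_congr key).trans ((tsum_sum_antidiagonal fun i j => if i = 0 then 0 else
          (K.multichoose i : ℝ≥0∞) * ENNReal.ofReal x ^ i *
            (extCount m i j * ENNReal.ofReal x ^ j)).trans ?_)
    have key2 : ∀ i, (∑' j, (if i = 0 then 0 else
          (K.multichoose i : ℝ≥0∞) * ENNReal.ofReal x ^ i *
            (extCount m i j * ENNReal.ofReal x ^ j))) =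
        ENNReal.ofReal ((K.multichoose i : ℝ) * (x * forestGF l (m + 1)) ^ i -
          (K.multichoose i : ℝ) * (x * forestGF l m) ^ i) := by
      intro i
      split_ifs with hi
      · simp [hi]
      · rw [ENNReal.tsum_mul_left, ih i hi, ← ENNReal.ofReal_natCast, ← ENNReal.ofReal_pow hx0,
          ← ENNReal.ofReal_mul (by positivity), ← ENNReal.ofReal_mul (by positivity)]
        congr 1
        rw [mul_pow, mul_pow]; ring
    simp_rw [key2]
    have hs := (hasSum_multichoose_forestGF h0 h1 K (m + 1)).sub
      (hasSum_multichoose_forestGF h0 h1 K m)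
    rw [← ENNReal.ofReal_tsum_of_nonneg _ hs.summable, hs.tsum_eq]
    intro i
    rw [← mul_sub]
    refine mul_nonneg (by positivity) (sub_nonneg.2 ?_)
    exact pow_le_pow_left₀ (mul_nonneg hx0 (forestGF_nonneg h0 h1 m))
      (mul_le_mul_of_nonneg_left (forestGF_mono h0 h1 m) hx0) i

end real

/-! ### Coefficient asymptotics at a simple pole -/

/-- Multiplying the series by `g - x` removes the pole and gives coefficients `q n = g f n - f (n -
1)`. By the identity theorem this is the Taylor series of `H`, so it converges at `g < R`; there its
partial sums telescope to `f n * g ^ (n + 1)`. -/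
theorem tendsto_coeff_of_simple_pole {f : ℕ → ℝ} {S : ℝ → ℝ} {H : ℂ → ℂ} {g R ε : ℝ} (hg : 0 < g)
    (hR : g < R) (hε : 0 < ε) (hH : DifferentiableOn ℂ H (Metric.ball 0 R))
    (hf : ∀ x : ℝ, 0 < x → x < ε →
      HasSum (fun n => f n * x ^ n) (S x) ∧ H x = ((g - x : ℝ) : ℂ) * S x) :
    Tendsto (fun n => ((f n * g ^ (n + 1) : ℝ) : ℂ)) atTop (𝓝 (H g)) := by
  let q : ℕ → ℂ := fun n => ((g * f n - if n = 0 then 0 else f (n - 1) : ℝ) : ℂ)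
  have hq : ∀ x : ℝ, 0 < x → x < ε → HasSum (fun n => q n * (x : ℂ) ^ n) (H x) := by
    intro x h0 h1
    obtain ⟨hs, he⟩ := hf x h0 h1
    have h2 : HasSum (fun n => (if n = 0 then 0 else f (n - 1)) * x ^ n) (x * S x) := by
      rw [← hasSum_nat_add_iff' 1]
      simp only [Nat.add_eq_zero_iff, one_ne_zero, and_false, if_false, Nat.add_sub_cancel,
        Finset.range_one, Finset.sum_singleton, if_true, zero_mul, sub_zero]
      refine (hs.mul_left x).congr_fun fun n => ?_
      ring
    have h3 := (hs.mul_left g).sub h2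
    rw [he, ← Complex.ofReal_mul, sub_mul]
    rw [← Complex.hasSum_ofReal] at h3
    convert h3 using 2 with n
    simp only [q]
    push_cast
    ring
  obtain ⟨R', hR1, hR2⟩ := exists_between hR
  lift R' to NNReal using by linarith
  have hF := DifferentiableOn.hasFPowerSeriesOnBall (R := R')
    (hH.mono (Metric.closedBall_subset_ball hR2)) (by exact_mod_cast hg.trans hR1)
  have hrad : (0 : ℝ≥0∞) < (FormalMultilinearSeries.ofScalars ℂ q).radius := by
    have h := (hq (ε / 2) (by linarith) (by linarith)).summable.norm
    obtain ⟨δ, hδ⟩ : ∃ δ : NNReal, (δ : ℝ) = ε / 2 := ⟨⟨ε / 2, by linarith⟩, rfl⟩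
    refine lt_of_lt_of_le (b := (δ : ℝ≥0∞)) ?_
      (FormalMultilinearSeries.le_radius_of_summable_norm _ ?_)
    · rw [ENNReal.coe_pos, ← NNReal.coe_pos, hδ]
      exact half_pos hε
    · convert h using 2 with n
      rw [FormalMultilinearSeries.ofScalars_norm, norm_mul, norm_pow,
        Complex.norm_of_nonneg (half_pos hε).le, hδ]
  have hG := (FormalMultilinearSeries.ofScalars ℂ q).hasFPowerSeriesOnBall hrad
  have hfreq : ∃ᶠ z in 𝓝[≠] (0 : ℂ), (FormalMultilinearSeries.ofScalars ℂ q).sum z = H z := by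
    have ht : Tendsto (fun x : ℝ => (x : ℂ)) (𝓝[>] 0) (𝓝[≠] 0) := by
      refine tendsto_nhdsWithin_iff.2 ⟨?_, ?_⟩
      · exact (Complex.continuous_ofReal.tendsto' 0 0 rfl).mono_left nhdsWithin_le_nhds
      · filter_upwards [self_mem_nhdsWithin] with x hx
        simpa using ne_of_gt hx
    refine ht.frequently (Eventually.frequently ?_)
    filter_upwards [Ioo_mem_nhdsGT hε] with x hx
    rw [← (hq x hx.1 hx.2).tsum_eq]
    refine tsum_congr fun n => ?_
    rw [FormalMultilinearSeries.apply_eq_pow_smul_coeff, FormalMultilinearSeries.coeff_ofScalars,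
      smul_eq_mul, mul_comm]
  have heq := (hG.analyticAt.frequently_eq_iff_eventually_eq hF.analyticAt).1 hfreq
  have hp := (hG.hasFPowerSeriesAt.congr heq).eq_formalMultilinearSeries hF.hasFPowerSeriesAt
  have hsum := hF.hasSum (y := (g : ℂ))
    (by simpa [abs_of_pos hg, ← NNReal.coe_lt_coe, enorm_eq_nnnorm] using hR1)
  rw [← hp, zero_add] at hsum
  simp only [FormalMultilinearSeries.apply_eq_pow_smul_coeff,
    FormalMultilinearSeries.coeff_ofScalars, smul_eq_mul] at hsum
  refine (hsum.tendsto_sum_nat.comp (tendsto_add_atTop_nat 1)).congr fun n => ?_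
  simp only [Function.comp_def]
  induction n with
  | zero => simp [q]; ring
  | succ n ih =>
    rw [Finset.sum_range_succ, ih]
    simp only [q, Nat.add_eq_zero_iff, one_ne_zero, and_false, if_false, Nat.add_sub_cancel]
    push_cast
    ring

/-! ### Analytic continuation of the weighted generating function -/

theorem exists_norm_one_sub_pow_sub_le (M : ℝ) (K : ℕ) :
    ∃ C : ℝ, 0 ≤ C ∧ ∀ e : ℂ, ‖e‖ ≤ M → ‖(1 - e) ^ K - (1 - K * e)‖ ≤ C * ‖e‖ ^ 2 := by
  induction K with
  | zero => exact ⟨0, le_rfl, fun e _ => by simp⟩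
  | succ K ih =>
    obtain ⟨C, hC, h⟩ := ih
    refine ⟨(1 + |M|) * C + K, by positivity, fun e he => ?_⟩
    have : (1 - e) ^ (K + 1) - (1 - (K + 1 : ℕ) * e) =
        (1 - e) * ((1 - e) ^ K - (1 - K * e)) + K * e ^ 2 := by push_cast; ring
    rw [this]
    refine (norm_add_le _ _).trans ?_
    rw [norm_mul, norm_mul, norm_pow, add_mul, mul_assoc, Complex.norm_natCast]
    gcongr
    · refine (norm_sub_le _ _).trans ?_
      rw [norm_one]
      exact add_le_add le_rfl (he.trans (le_abs_self M))
    · exact h e he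

/-- The deviation of the power `K` of the forest generating function from its linearization. -/
noncomputable def forestRemainder (K : ℕ) (l : ℂ) (m : ℕ) : ℂ :=
  forestGF l m ^ K - (1 + l) ^ K * (1 - K * (l ^ m * (1 - l)))

theorem one_sub_pow_ne_zero {l : ℂ} (h : ‖l‖ < 1) (m : ℕ) : 1 - l ^ (m + 1) ≠ 0 := by
  intro h0
  have h1 : ‖l ^ (m + 1)‖ = 1 := by rw [← sub_eq_zero.1 h0, norm_one]
  rw [norm_pow] at h1
  exact (pow_lt_one₀ (norm_nonneg _) h (by omega)).ne h1

/-- Write `forestGF l m = (1 + l) (1 - e)`, where `e` is `l ^ m (1 - l)` divided by `1 - l ^ (m +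
1)`. The quadratic Taylor error in `e` and the error from dropping that denominator are both of
order `ρ ^ (2 m)`. -/
theorem exists_norm_forestRemainder_le {ρ : ℝ} (h1 : ρ < 1) (K : ℕ) :
    ∃ C : ℝ, 0 ≤ C ∧ ∀ l : ℂ, ‖l‖ ≤ ρ → ∀ m, ‖forestRemainder K l m‖ ≤ C * (ρ ^ 2) ^ m := by
  -- `2 / (1 - ρ)` bounds `‖e‖`: the numerator of `e` has norm at most 2 and its denominator at
  -- least `1 - ρ`.
  obtain ⟨C, hC, h⟩ := exists_norm_one_sub_pow_sub_le (2 / (1 - ρ)) K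
  have h1' : 0 < 1 - ρ := by linarith
  refine ⟨2 ^ K * (C * (2 / (1 - ρ)) ^ 2 + K * (2 / (1 - ρ))), by positivity, fun l hl m => ?_⟩
  have h0 : 0 ≤ ρ := (norm_nonneg _).trans hl
  have hl1 : ‖l‖ < 1 := hl.trans_lt h1
  have hd := one_sub_pow_ne_zero hl1 m
  set e : ℂ := l ^ m * (1 - l) / (1 - l ^ (m + 1)) with he
  have hpow : ∀ k, ‖l‖ ^ k ≤ ρ ^ k := fun k => pow_le_pow_left₀ (norm_nonneg _) hl k
  have hden : 1 - ρ ≤ ‖1 - l ^ (m + 1)‖ := by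
    have a1 := norm_sub_norm_le (1 : ℂ) (l ^ (m + 1))
    rw [norm_one, norm_pow] at a1
    have a2 := hpow (m + 1)
    have a3 : ρ ^ (m + 1) ≤ ρ := by
      simpa using pow_le_pow_of_le_one h0 h1.le (show 1 ≤ m + 1 by omega)
    linarith
  have h1l : ‖1 - l‖ ≤ 2 := by
    refine (norm_sub_le _ _).trans ?_
    rw [norm_one]; linarith
  have h1l' : ‖1 + l‖ ≤ 2 := by
    refine (norm_add_le _ _).trans ?_
    rw [norm_one]; linarith
  have hem : ‖e‖ ≤ 2 / (1 - ρ) * ρ ^ m := by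
    rw [he, norm_div, norm_mul, norm_pow, div_mul_eq_mul_div, mul_comm (2 : ℝ)]
    gcongr
  have hρm : ρ ^ m ≤ 1 := pow_le_one₀ h0 h1.le
  have heM : ‖e‖ ≤ 2 / (1 - ρ) := hem.trans (mul_le_of_le_one_right (by positivity) hρm)
  have hY : forestGF l m = (1 + l) * (1 - e) := by
    rw [forestGF, he]
    field_simp
    ring
  have hdiff : e - l ^ m * (1 - l) = l ^ (m + 1) * e := by
    rw [he]
    field_simp
    ring
  have : forestRemainder K l m =
      (1 + l) ^ K * (((1 - e) ^ K - (1 - K * e)) - K * (l ^ (m + 1) * e)) := by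
    rw [forestRemainder, hY, mul_pow, ← hdiff]
    ring
  rw [this, norm_mul, norm_pow, mul_assoc]
  gcongr
  refine (norm_sub_le _ _).trans ?_
  rw [add_mul]
  refine add_le_add ((h e heM).trans ?_) ?_
  · rw [mul_assoc]
    gcongr
    calc ‖e‖ ^ 2 ≤ (2 / (1 - ρ) * ρ ^ m) ^ 2 := by gcongr
      _ = _ := by rw [mul_pow, ← pow_mul, ← pow_mul, mul_comm m 2]
  · rw [norm_mul, norm_mul, norm_pow, Complex.norm_natCast, mul_assoc]
    refine mul_le_mul_of_nonneg_left ?_ (Nat.cast_nonneg K)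
    calc ‖l‖ ^ (m + 1) * ‖e‖ ≤ ρ ^ m * (2 / (1 - ρ) * ρ ^ m) := by
          gcongr
          exact (hpow _).trans (pow_le_pow_of_le_one h0 h1.le (by omega))
      _ = 2 / (1 - ρ) * (ρ ^ 2) ^ m := by rw [← pow_mul, two_mul, pow_add]; ring

/-- The part of the weighted generating function which is regular at the dominant singularity. -/
noncomputable def regularPart (a : ℝ) (K : ℕ) (l : ℂ) : ℂ :=
  ∑' m : ℕ, (a : ℂ) ^ m * (forestRemainder K l (m + 1) - forestRemainder K l m)

theorem exists_norm_regularPart_term_le {a ρ : ℝ} (ha : 0 < a) (h1 : ρ < 1)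
    (K : ℕ) : ∃ C : ℝ, ∀ l : ℂ, ‖l‖ ≤ ρ → ∀ m,
      ‖(a : ℂ) ^ m * (forestRemainder K l (m + 1) - forestRemainder K l m)‖ ≤
        C * (a * ρ ^ 2) ^ m := by
  obtain ⟨C, hC, h⟩ := exists_norm_forestRemainder_le h1 K
  refine ⟨C * 2, fun l hl m => ?_⟩
  have h0 : 0 ≤ ρ := (norm_nonneg _).trans hl
  rw [norm_mul, norm_pow, Complex.norm_real, Real.norm_of_nonneg ha.le, mul_pow, mul_comm (C * 2),
    mul_assoc]
  gcongr
  refine (norm_sub_le _ _).trans ?_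
  have h2 : (ρ ^ 2) ^ (m + 1) ≤ (ρ ^ 2) ^ m :=
    pow_le_pow_of_le_one (by positivity) (pow_le_one₀ h0 h1.le) (by omega)
  have := h l hl m
  have := h l hl (m + 1)
  have := mul_le_mul_of_nonneg_left h2 hC
  linarith

theorem differentiableOn_regularPart {a ρ : ℝ} (ha : 0 < a) (h1 : ρ < 1)
    (hρ : a * ρ ^ 2 < 1) (K : ℕ) :
    DifferentiableOn ℂ (regularPart a K) (Metric.ball 0 ρ) := by
  obtain ⟨C, hC⟩ := exists_norm_regularPart_term_le ha h1 K
  have hne : ∀ m : ℕ, ∀ l ∈ Metric.ball (0 : ℂ) ρ, 1 - l ^ (m + 1) ≠ 0 := fun m l hl =>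
    one_sub_pow_ne_zero ((mem_ball_zero_iff.1 hl).trans h1) m
  have hd : ∀ m, DifferentiableOn ℂ (fun l => forestRemainder K l m) (Metric.ball 0 ρ) := by
    intro m
    have : DifferentiableOn ℂ (fun l : ℂ => forestGF l m) (Metric.ball 0 ρ) :=
      DifferentiableOn.div (by fun_prop) (by fun_prop) (hne m)
    unfold forestRemainder
    fun_prop
  refine Complex.differentiableOn_tsum_of_summable_norm (u := fun m => C * (a * ρ ^ 2) ^ m)
    ((summable_geometric_of_lt_one (by positivity) hρ).mul_left C)
    (fun m => ((hd (m + 1)).sub (hd m)).const_mul _) Metric.isOpen_ball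
    fun m l hl => hC l (mem_ball_zero_iff.1 hl).le m

/-- The linear parts of consecutive powers differ by `K (1 + l) ^ K (1 - l) ^ 2 l ^ m`. Summed
against `a ^ m` this is the geometric series that carries the pole at `a l = 1`; the remainder
converges past it. -/
theorem hasSum_forestGF_sub {a ρ : ℝ} (ha : 0 < a) (h1 : ρ < 1) (hρ : a * ρ ^ 2 < 1) (K : ℕ)
    {l : ℂ} (hl : ‖l‖ ≤ ρ) (hal : ‖(a : ℂ) * l‖ < 1) :
    HasSum (fun m => (a : ℂ) ^ m * (forestGF l (m + 1) ^ K - forestGF l m ^ K))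
      (K * (1 + l) ^ K * (1 - l) ^ 2 * (1 - a * l)⁻¹ + regularPart a K l) := by
  obtain ⟨C, hC⟩ := exists_norm_regularPart_term_le ha h1 K
  have hs : Summable fun m => (a : ℂ) ^ m * (forestRemainder K l (m + 1) - forestRemainder K l m) :=
    Summable.of_norm_bounded
      ((summable_geometric_of_lt_one (by positivity) hρ).mul_left C) (hC l hl)
  have h2 := ((hasSum_geometric_of_norm_lt_one hal).mul_left
    (K * (1 + l) ^ K * (1 - l) ^ 2)).add hs.hasSum
  refine h2.congr_fun fun m => ?_
  simp only [forestRemainder, mul_pow]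
  ring

/-- Up to the change of variable `x = l / (1 + l) ^ 2`, the weighted generating function of the
extensions of a tree with `K` vertices at its top level. -/
theorem hasSum_extWeight {a ρ : ℝ} (ha : 0 < a) (h1 : ρ < 1) (hρ : a * ρ ^ 2 < 1) {K : ℕ}
    (hK : K ≠ 0) {l : ℝ} (h0 : 0 < l) (hl : l ≤ ρ) (hal : a * l < 1) :
    (∀ n, extWeight (ENNReal.ofReal a) K n ≠ ∞) ∧
    ∃ S : ℝ, HasSum (fun n => (extWeight (ENNReal.ofReal a) K n).toReal * (l / (1 + l) ^ 2) ^ n) S ∧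
      (S : ℂ) = K * (1 + (l : ℂ)) ^ K * (1 - (l : ℂ)) ^ 2 * (1 - a * (l : ℂ))⁻¹ +
        regularPart a K l := by
  have hl1 : l < 1 := hl.trans_lt h1
  have hx : 0 < l / (1 + l) ^ 2 := by positivity
  have hc := hasSum_forestGF_sub ha h1 hρ K (l := (l : ℂ))
    (by rwa [Complex.norm_real, Real.norm_of_nonneg h0.le])
    (by rwa [← Complex.ofReal_mul, Complex.norm_real, Real.norm_of_nonneg (by positivity)])
  have hcast : ∀ m, (a : ℂ) ^ m * (forestGF (l : ℂ) (m + 1) ^ K - forestGF (l : ℂ) m ^ K) =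
      ((a ^ m * (forestGF l (m + 1) ^ K - forestGF l m ^ K) : ℝ) : ℂ) := by
    intro m
    simp only [forestGF]
    push_cast
    rfl
  simp_rw [hcast] at hc
  have hr := (Complex.summable_ofReal.1 hc.summable).hasSum
  set S := ∑' m, a ^ m * (forestGF l (m + 1) ^ K - forestGF l m ^ K) with hS
  have hSc := (Complex.hasSum_ofReal.2 hr).unique hc
  have hnn : ∀ m, 0 ≤ forestGF l (m + 1) ^ K - forestGF l m ^ K := fun m =>
    sub_nonneg.2 (pow_le_pow_left₀ (forestGF_nonneg h0 hl1 m) (forestGF_mono h0 hl1 m) K)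
  have hS0 : 0 ≤ S := tsum_nonneg fun m => mul_nonneg (by positivity) (hnn m)
  have hE : ∑' n, extWeight (ENNReal.ofReal a) K n * ENNReal.ofReal (l / (1 + l) ^ 2) ^ n =
      ENNReal.ofReal S := by
    simp_rw [extWeight, ← ENNReal.tsum_mul_right]
    rw [ENNReal.tsum_comm]
    simp_rw [mul_assoc, ENNReal.tsum_mul_left, tsum_extCount h0 hl1 _ K hK]
    rw [hS, ENNReal.ofReal_tsum_of_nonneg (fun m => mul_nonneg (by positivity) (hnn m)) hr.summable]
    refine tsum_congr fun m => ?_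
    rw [ENNReal.ofReal_mul (by positivity), ENNReal.ofReal_pow ha.le]
  have hne : ∑' n, extWeight (ENNReal.ofReal a) K n * ENNReal.ofReal (l / (1 + l) ^ 2) ^ n ≠ ∞ := by
    rw [hE]; exact ENNReal.ofReal_ne_top
  refine ⟨fun n hn => ENNReal.ne_top_of_tsum_ne_top hne n ?_, S, ?_, hSc⟩
  · rw [hn, ENNReal.top_mul]
    exact pow_ne_zero _ (ENNReal.ofReal_pos.2 hx).ne'
  · have h2 := ENNReal.hasSum_toReal hne
    rw [← ENNReal.tsum_toReal_eq (ENNReal.ne_top_of_tsum_ne_top hne), hE,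
      ENNReal.toReal_ofReal hS0] at h2
    convert h2 using 2 with n
    rw [ENNReal.toReal_mul, ENNReal.toReal_pow, ENNReal.toReal_ofReal hx.le]

/-! ### The change of variable -/

/-- The analytic inverse of `l ↦ l / (1 + l) ^ 2` on the disc of radius `1 / 4`. -/
noncomputable def koebeInv (z : ℂ) : ℂ :=
  (1 - (1 - 4 * z) ^ (1 / 2 : ℂ)) / (1 + (1 - 4 * z) ^ (1 / 2 : ℂ))

theorem re_cpow_half_pos {w : ℂ} (hw : 0 < w.re) : 0 < (w ^ (1 / 2 : ℂ)).re := by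
  have hw0 : w ≠ 0 := by rintro rfl; simp at hw
  rw [Complex.cpow_def_of_ne_zero hw0, Complex.exp_re]
  refine mul_pos (Real.exp_pos _) (Real.cos_pos_of_mem_Ioo ?_)
  have h := abs_lt.1 (Complex.abs_arg_lt_pi_div_two_iff.2 (Or.inl hw))
  have him : (Complex.log w * (1 / 2)).im = w.arg / 2 := by
    have : (1 / 2 : ℂ) = ((1 / 2 : ℝ) : ℂ) := by push_cast; rfl
    rw [this, Complex.im_mul_ofReal, Complex.log_im]
    ring
  rw [him]
  constructor <;> linarith [h.1, h.2, Real.pi_pos]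

theorem re_one_sub_pos {z : ℂ} (hz : ‖z‖ < 1 / 4) : 0 < (1 - 4 * z).re := by
  have h1 := Complex.re_le_norm z
  have : (1 - 4 * z).re = 1 - 4 * z.re := by simp
  linarith

/-- The principal square root `w` has positive real part, so `w` is closer to `1` than to `-1`. -/
theorem norm_koebeInv_lt_one {z : ℂ} (hz : ‖z‖ < 1 / 4) : ‖koebeInv z‖ < 1 := by
  have h := re_cpow_half_pos (re_one_sub_pos hz)
  set w := (1 - 4 * z) ^ (1 / 2 : ℂ) with hw
  have hlt : ‖1 - w‖ < ‖1 + w‖ := by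
    rw [← sq_lt_sq₀ (norm_nonneg _) (norm_nonneg _), Complex.sq_norm, Complex.sq_norm,
      Complex.normSq_apply, Complex.normSq_apply]
    simp
    nlinarith
  rw [koebeInv, ← hw, norm_div, div_lt_one ((norm_nonneg _).trans_lt hlt)]
  exact hlt

theorem koebe_koebeInv {z : ℂ} (hz : ‖z‖ < 1 / 4) :
    koebeInv z / (1 + koebeInv z) ^ 2 = z := by
  have h := re_cpow_half_pos (re_one_sub_pos hz)
  have hsq : ((1 - 4 * z) ^ (1 / 2 : ℂ)) ^ 2 = 1 - 4 * z := by
    rw [one_div]; exact_mod_cast Complex.cpow_nat_inv_pow (1 - 4 * z) (n := 2) (by norm_num)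
  rw [koebeInv]
  set w := (1 - 4 * z) ^ (1 / 2 : ℂ) with hw
  have h1 : 1 + w ≠ 0 := by
    intro h0
    have := congrArg Complex.re h0
    simp at this
    linarith
  have h2 : 1 + (1 - w) / (1 + w) = 2 / (1 + w) := by field_simp; ring
  rw [h2]
  field_simp
  linear_combination -hsq

theorem one_add_ne_zero_of_norm_lt {l : ℂ} (h : ‖l‖ < 1) : 1 + l ≠ 0 := by
  intro h0
  have : l = -1 := by linear_combination h0
  rw [this] at h
  simp at h

/-- The fibres of `l ↦ l / (1 + l) ^ 2` are the pairs `l`, `1 / l`, and only one member lies in the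
unit disc. -/
theorem koebeInv_koebe {l : ℝ} (h0 : 0 < l) (h1 : l < 1) :
    koebeInv ((l / (1 + l) ^ 2 : ℝ) : ℂ) = l := by
  have hz : ‖((l / (1 + l) ^ 2 : ℝ) : ℂ)‖ < 1 / 4 := by
    rw [Complex.norm_of_nonneg (by positivity), div_lt_div_iff₀ (by positivity) (by norm_num)]
    nlinarith [sq_pos_of_pos (sub_pos.2 h1)]
  have h := koebe_koebeInv hz
  have hn := norm_koebeInv_lt_one hz
  set k := koebeInv ((l / (1 + l) ^ 2 : ℝ) : ℂ) with hk
  have hk1 := one_add_ne_zero_of_norm_lt hn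
  have hl : ‖(l : ℂ)‖ < 1 := by rwa [Complex.norm_of_nonneg h0.le]
  have hl1 := one_add_ne_zero_of_norm_lt hl
  push_cast at h
  rw [div_eq_div_iff (pow_ne_zero _ hk1) (pow_ne_zero _ hl1)] at h
  have h2 : (k - l) * (1 - k * l) = 0 := by linear_combination h
  rcases mul_eq_zero.1 h2 with h3 | h3
  · exact sub_eq_zero.1 h3
  · exfalso
    have h4 : ‖k * l‖ = 1 := by rw [← sub_eq_zero.1 h3, norm_one]
    rw [norm_mul] at h4
    nlinarith [norm_nonneg k, norm_nonneg (l : ℂ)]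

theorem koebe_le_quarter {ρ : ℝ} (h0 : 0 ≤ ρ) : ρ / (1 + ρ) ^ 2 ≤ 1 / 4 := by
  rw [div_le_div_iff₀ (by positivity) (by norm_num)]
  nlinarith [sq_nonneg (1 - ρ)]

/-- On a circle `‖k‖ = t` the map is smallest in norm at `k = t`, and `t / (1 + t) ^ 2` increases on
`[0, 1]`. -/
theorem norm_koebeInv_lt {ρ : ℝ} (h0 : 0 < ρ) {z : ℂ} (hz : ‖z‖ < ρ / (1 + ρ) ^ 2) :
    ‖koebeInv z‖ < ρ := by
  have hz4 := hz.trans_le (koebe_le_quarter h0.le)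
  by_contra! hle
  have hn := norm_koebeInv_lt_one hz4
  have h := koebe_koebeInv hz4
  set k := koebeInv z
  have h2 : ‖z‖ = ‖k‖ / ‖1 + k‖ ^ 2 := by rw [← h, norm_div, norm_pow]
  have h3 : ‖1 + k‖ ≤ 1 + ‖k‖ := (norm_add_le _ _).trans (by rw [norm_one])
  have h4 : 0 < ‖1 + k‖ := norm_pos_iff.2 (one_add_ne_zero_of_norm_lt hn)
  have h5 : ‖k‖ / (1 + ‖k‖) ^ 2 ≤ ‖z‖ := by rw [h2]; gcongr
  have h6 := h5.trans_lt hz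
  rw [div_lt_div_iff₀ (by positivity) (by positivity)] at h6
  have h7 : 0 ≤ (‖k‖ - ρ) * (1 - ‖k‖ * ρ) :=
    mul_nonneg (by linarith) (by nlinarith)
  nlinarith

theorem differentiableOn_koebeInv : DifferentiableOn ℂ koebeInv (Metric.ball 0 (1 / 4)) := by
  have hw : DifferentiableOn ℂ (fun z : ℂ => (1 - 4 * z) ^ (1 / 2 : ℂ))
      (Metric.ball 0 (1 / 4)) := by
    refine DifferentiableOn.cpow_const (by fun_prop) fun z hz => ?_
    exact Or.inl (re_one_sub_pos (mem_ball_zero_iff.1 hz))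
  refine DifferentiableOn.div (by fun_prop) (by fun_prop) fun z hz h0 => ?_
  have h := re_cpow_half_pos (re_one_sub_pos (mem_ball_zero_iff.1 hz))
  have := congrArg Complex.re h0
  simp only [Complex.add_re, Complex.one_re, Complex.zero_re] at this
  linarith

/-! ### Asymptotics of the weighted number of extensions -/

theorem koebe_strictMonoOn {l ρ : ℝ} (h0 : 0 < l) (hl : l < ρ) (h1 : ρ < 1) :
    l / (1 + l) ^ 2 < ρ / (1 + ρ) ^ 2 := by
  have : 0 < ρ := h0.trans hl
  rw [div_lt_div_iff₀ (by positivity) (by positivity)]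
  have : 0 < (ρ - l) * (1 - ρ * l) := mul_pos (by linarith) (by nlinarith)
  nlinarith

/-- A positive constant which governs the asymptotics of `extWeight`. -/
noncomputable def poleConst (a : ℝ) : ℝ := a⁻¹ * (1 - a⁻¹) ^ 3 * (1 + a⁻¹) / (1 + a⁻¹) ^ 4

/-- At `ρ = 1 / a` the product `a ρ ^ 2` equals `1 / a < 1`, which leaves room to pass beyond the
pole. -/
theorem exists_radius {a : ℝ} (ha : 1 < a) : ∃ ρ : ℝ, a⁻¹ < ρ ∧ ρ < 1 ∧ a * ρ ^ 2 < 1 := by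
  have h0 : 0 < a := by linarith
  have hlim : Tendsto (fun ρ : ℝ => a * ρ ^ 2) (𝓝[>] a⁻¹) (𝓝 (a * a⁻¹ ^ 2)) :=
    ((continuous_const.mul (continuous_pow 2)).tendsto _).mono_left nhdsWithin_le_nhds
  have h1 : a * a⁻¹ ^ 2 < 1 := by
    rw [pow_two, ← mul_assoc, mul_inv_cancel₀ h0.ne', one_mul]
    exact inv_lt_one_of_one_lt₀ ha
  obtain ⟨ρ, h2, h3⟩ := ((hlim.eventually (gt_mem_nhds h1)).and
    (Ioo_mem_nhdsGT (inv_lt_one_of_one_lt₀ ha))).exists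
  exact ⟨ρ, h3.1, h3.2, h2⟩

theorem extWeight_ne_top {a : ℝ} (ha : 1 < a) {K : ℕ} (hK : K ≠ 0) (n : ℕ) :
    extWeight (ENNReal.ofReal a) K n ≠ ∞ := by
  obtain ⟨ρ, h1, h2, h3⟩ := exists_radius ha
  have h0 : 0 < a⁻¹ := by positivity
  refine (hasSum_extWeight (l := a⁻¹ / 2) (by linarith) h2 h3 hK (by positivity) (by linarith)
    ?_).1 n
  rw [← mul_div_assoc, mul_inv_cancel₀ (by linarith)]
  norm_num

theorem tendsto_extWeight {a : ℝ} (ha : 1 < a) {K : ℕ} (hK : K ≠ 0) :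
    Tendsto (fun n => (extWeight (ENNReal.ofReal a) K n).toReal * (a / (1 + a) ^ 2) ^ (n + 1)) atTop
      (𝓝 (K * (1 + a⁻¹) ^ K * poleConst a)) := by
  obtain ⟨ρ, h1, h2, h3⟩ := exists_radius ha
  have ha0 : 0 < a := by linarith
  have hi0 : 0 < a⁻¹ := by positivity
  have hi1 : a⁻¹ < 1 := inv_lt_one_of_one_lt₀ ha
  have hg : a / (1 + a) ^ 2 = a⁻¹ / (1 + a⁻¹) ^ 2 := by field_simp; ring
  have habR : a * a⁻¹ = 1 := mul_inv_cancel₀ ha0.ne'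
  rw [hg, poleConst]
  generalize a⁻¹ = b at *
  have hab : (a : ℂ) * b = 1 := by exact_mod_cast habR
  have hρ0 : 0 < ρ := hi0.trans h1
  set g := b / (1 + b) ^ 2 with hgdef
  have hg0 : 0 < g := by positivity
  have hgR : g < ρ / (1 + ρ) ^ 2 := koebe_strictMonoOn hi0 h1 h2
  -- This is `g - z` times the generating function, with the pole cancelled by hand: `g - z` has the
  -- factor `1 - a l`, `l = koebeInv z`, and the fraction is the cofactor.
  set H : ℂ → ℂ := fun z => K * (1 + koebeInv z) ^ K * (1 - koebeInv z) ^ 2 *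
      (b * (1 - koebeInv z * b) / ((1 + koebeInv z) ^ 2 * (1 + (b : ℂ)) ^ 2)) +
      (g - z) * regularPart a K (koebeInv z) with hH
  have hHd : DifferentiableOn ℂ H (Metric.ball 0 (ρ / (1 + ρ) ^ 2)) := by
    have hk : DifferentiableOn ℂ koebeInv (Metric.ball 0 (ρ / (1 + ρ) ^ 2)) :=
      differentiableOn_koebeInv.mono (Metric.ball_subset_ball (koebe_le_quarter hρ0.le))
    have hr : DifferentiableOn ℂ (fun z => regularPart a K (koebeInv z))
        (Metric.ball 0 (ρ / (1 + ρ) ^ 2)) :=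
      (differentiableOn_regularPart ha0 h2 h3 K).comp hk fun z hz =>
        mem_ball_zero_iff.2 (norm_koebeInv_lt hρ0 (mem_ball_zero_iff.1 hz))
    have hne : ∀ z ∈ Metric.ball (0 : ℂ) (ρ / (1 + ρ) ^ 2),
        (1 + koebeInv z) ^ 2 * (1 + (b : ℂ)) ^ 2 ≠ 0 := by
      intro z hz
      refine mul_ne_zero (pow_ne_zero _ (one_add_ne_zero_of_norm_lt
        ((norm_koebeInv_lt hρ0 (mem_ball_zero_iff.1 hz)).trans h2))) (pow_ne_zero _ ?_)
      have : (0 : ℝ) < 1 + b := by positivity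
      exact_mod_cast this.ne'
    have hdiv := DifferentiableOn.fun_div (by fun_prop : DifferentiableOn ℂ
      (fun z => (b : ℂ) * (1 - koebeInv z * (b : ℂ))) (Metric.ball 0 (ρ / (1 + ρ) ^ 2)))
      (by fun_prop) hne
    exact ((by fun_prop : DifferentiableOn ℂ (fun z : ℂ => (K : ℂ) * (1 + koebeInv z) ^ K *
      (1 - koebeInv z) ^ 2) (Metric.ball 0 (ρ / (1 + ρ) ^ 2))).mul hdiv).add
      ((by fun_prop : DifferentiableOn ℂ (fun z : ℂ => (g : ℂ) - z) _).mul hr)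
  have hmain := tendsto_coeff_of_simple_pole
    (f := fun n => (extWeight (ENNReal.ofReal a) K n).toReal)
    (S := fun x => ∑' n, (extWeight (ENNReal.ofReal a) K n).toReal * x ^ n) hg0 hgR hg0 hHd ?_
  · have hHg : H g = ((K * (1 + b) ^ K * (b * (1 - b) ^ 3 * (1 + b) / (1 + b) ^ 4) : ℝ) : ℂ) := by
      have hk : koebeInv (g : ℂ) = ((b : ℝ) : ℂ) := koebeInv_koebe hi0 hi1
      have h1a : (1 + (b : ℂ)) ≠ 0 := by
        have : (0 : ℝ) < 1 + b := by positivity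
        exact_mod_cast this.ne'
      rw [hH]
      simp only [hk, sub_self, zero_mul, add_zero]
      push_cast
      field_simp
      ring
    rw [hHg] at hmain
    exact (Complex.continuous_re.tendsto _).comp hmain
  · intro x hx0 hxg
    have hx4 : x < 1 / 4 := (hxg.trans hgR).trans_le (koebe_le_quarter hρ0.le)
    have hs0 : 0 < √(1 - 4 * x) := Real.sqrt_pos.2 (by linarith)
    have hs1 : √(1 - 4 * x) < 1 := by
      rw [Real.sqrt_lt' one_pos]; linarith
    have hsq : √(1 - 4 * x) ^ 2 = 1 - 4 * x := Real.sq_sqrt (by linarith)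
    generalize √(1 - 4 * x) = s at hs0 hs1 hsq
    -- The root in `(0, 1)` of `x (1 + l) ^ 2 = l`.
    set l : ℝ := (1 - s) / (1 + s) with hl
    have hl0 : 0 < l := div_pos (by linarith) (by linarith)
    have hl1 : l < 1 := by rw [hl, div_lt_one (by linarith)]; linarith
    have hxl : x = l / (1 + l) ^ 2 := by
      have : 1 + l = 2 / (1 + s) := by rw [hl]; field_simp; ring
      rw [this, hl]
      field_simp
      linear_combination hsq
    have hla : l < b := by
      by_contra! hle
      rcases hle.eq_or_lt with h | h
      · rw [hxl, ← h] at hxg; exact lt_irrefl _ hxg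
      · have := koebe_strictMonoOn hi0 h hl1
        rw [← hxl] at this; exact lt_asymm this hxg
    have hal : a * l < 1 := by
      have := mul_lt_mul_of_pos_left hla ha0
      rwa [habR] at this
    obtain ⟨-, S, hS, hSc⟩ := hasSum_extWeight ha0 h2 h3 hK hl0 (hla.trans h1).le hal
    rw [← hxl] at hS
    refine ⟨hS.summable.hasSum, ?_⟩
    rw [hS.tsum_eq, hSc]
    have hk : koebeInv (x : ℂ) = l := by rw [hxl]; exact koebeInv_koebe hl0 hl1
    have e1 : (1 + (b : ℂ)) ≠ 0 := by
      have : (0 : ℝ) < 1 + b := by positivity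
      exact_mod_cast this.ne'
    have e2 : (1 + (l : ℂ)) ≠ 0 := by
      have : (0 : ℝ) < 1 + l := by positivity
      exact_mod_cast this.ne'
    have e3 : (1 - (a : ℂ) * l) ≠ 0 := by
      have : (0 : ℝ) < 1 - a * l := by linarith
      exact_mod_cast this.ne'
    have hdiff : ((g - x : ℝ) : ℂ) = (1 - a * (l : ℂ)) *
        (b * (1 - l * b) / ((1 + l) ^ 2 * (1 + (b : ℂ)) ^ 2)) := by
      rw [hxl, hgdef]
      push_cast
      field_simp
      linear_combination (l : ℂ) * (1 - l * b) * hab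
    rw [hH]
    simp only [hk]
    rw [mul_add, ← Complex.ofReal_sub]
    congr 1
    rw [hdiff]
    symm
    calc _ = K * (1 + (l : ℂ)) ^ K * (1 - (l : ℂ)) ^ 2 *
        (b * (1 - l * b) / ((1 + l) ^ 2 * (1 + (b : ℂ)) ^ 2)) *
          ((1 - a * (l : ℂ)) * (1 - a * (l : ℂ))⁻¹) := by ring
      _ = _ := by rw [mul_inv_cancel₀ e3, mul_one]

/-! ### Lists of children -/

/-- The possible parent lists of a generation whose parents are `K` vertices. -/
def ChildList (K : ℕ) : Type := {ℓ : List ℕ // ℓ.Pairwise (· ≤ ·) ∧ ∀ p ∈ ℓ, p < K}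

instance (K : ℕ) : Countable (ChildList K) := inferInstanceAs (Countable (Subtype _))

instance (K : ℕ) : MeasurableSpace (ChildList K) := ⊤

instance (K : ℕ) : DiscreteMeasurableSpace (ChildList K) := ⟨fun _ => trivial⟩

/-- The number of vertices of the generation encoded by a list of children. -/
def ChildList.length {K : ℕ} (ℓ : ChildList K) : ℕ := ℓ.1.length

/-- The empty generation. -/
def ChildList.empty (K : ℕ) : ChildList K := ⟨[], List.Pairwise.nil, by simp⟩

theorem ChildList.length_eq_zero {K : ℕ} {ℓ : ChildList K} :
    ℓ.length = 0 ↔ ℓ = ChildList.empty K := by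
  rw [ChildList.length, List.length_eq_zero_iff]
  exact ⟨fun h => Subtype.ext h, fun h => congrArg Subtype.val h⟩

/-- Sorting identifies multisets with sorted lists. -/
noncomputable def symEquivChildList (K L : ℕ) :
    Sym (Fin K) L ≃ {ℓ : ChildList K // ℓ.length = L} := by
  refine Equiv.ofBijective (fun m => ⟨⟨(m.1.sort (· ≤ ·)).map Fin.val, ?_, ?_⟩, ?_⟩) ⟨?_, ?_⟩
  · rw [List.pairwise_map]
    exact (m.1.pairwise_sort (· ≤ ·)).imp fun h => h
  · intro p hp
    obtain ⟨q, -, rfl⟩ := List.mem_map.1 hp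
    exact q.2
  · exact (List.length_map _).trans ((Multiset.length_sort _).trans m.2)
  · intro m m' h
    have h1 := congrArg (fun ℓ => ℓ.1.1) h
    have h2 := List.map_injective_iff.2 Fin.val_injective h1
    apply Subtype.ext
    rw [← m.1.sort_eq (· ≤ ·), ← m'.1.sort_eq (· ≤ ·), h2]
  · rintro ⟨⟨ℓ, hs, hlt⟩, hL⟩
    obtain ⟨ℓ', rfl⟩ : ∃ ℓ' : List (Fin K), ℓ'.map Fin.val = ℓ :=
      ⟨ℓ.pmap (fun p h => (⟨p, h⟩ : Fin K)) hlt, by simp [List.map_pmap]⟩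
    refine ⟨⟨(ℓ' : Multiset (Fin K)), by simpa [ChildList.length] using hL⟩, ?_⟩
    apply Subtype.ext
    apply Subtype.ext
    rw [List.pairwise_map] at hs
    change ((ℓ' : Multiset (Fin K)).sort (· ≤ ·)).map Fin.val = ℓ'.map Fin.val
    congr 1
    refine List.Perm.eq_of_pairwise' (r := (· ≤ ·)) (Multiset.pairwise_sort _ _) hs ?_
    rw [← Multiset.coe_eq_coe, Multiset.sort_eq]

theorem tsum_childList (K : ℕ) (φ : ℕ → ℝ≥0∞) :
    ∑' ℓ : ChildList K, φ ℓ.length = ∑' L, (K.multichoose L : ℝ≥0∞) * φ L := by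
  rw [← (Equiv.sigmaFiberEquiv (ChildList.length (K := K))).tsum_eq, ENNReal.tsum_sigma']
  refine tsum_congr fun L => ?_
  rw [← (symEquivChildList K L).tsum_eq]
  have : ∀ m : Sym (Fin K) L, φ ((Equiv.sigmaFiberEquiv (ChildList.length (K := K)))
      ⟨L, symEquivChildList K L m⟩).length = φ L := fun m => by
    rw [Equiv.sigmaFiberEquiv_apply, ((symEquivChildList K L) m).2]
  simp_rw [this]
  rw [tsum_fintype, Finset.sum_const, Finset.card_univ, Sym.card_sym_eq_multichoose,
    Fintype.card_fin, nsmul_eq_mul]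

/-! ### Cylinder sets -/

/-- The set of trees that agree with `T` up to height `r`. -/
def cyl (T : PlanarTree) (r : ℕ) : Set PlanarTree := {T' | ∀ s < r, T'.parents s = T.parents s}

theorem mem_cyl_self (T : PlanarTree) (r : ℕ) : T ∈ T.cyl r := fun _ _ => rfl

theorem cyl_eq_of_mem {T T' : PlanarTree} {r : ℕ} (h : T' ∈ T.cyl r) : T'.cyl r = T.cyl r := by
  ext T''
  exact ⟨fun h' s hs => (h' s hs).trans (h s hs), fun h' s hs => (h' s hs).trans (h s hs).symm⟩

theorem cyl_anti (T : PlanarTree) {r r' : ℕ} (h : r ≤ r') : T.cyl r' ⊆ T.cyl r :=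
  fun _ h' s hs => h' s (hs.trans_le h)

/-- All trees share the root edge, so a cylinder carries information only from the second generation
on; hence the index `r + 1` below. -/
theorem cyl_one (T : PlanarTree) : T.cyl 1 = Set.univ := by
  ext T'
  simp only [Set.mem_univ, iff_true]
  intro s hs
  obtain rfl : s = 0 := by omega
  rw [T.parents_zero, T'.parents_zero]

theorem ball_subset_cyl (T : PlanarTree) (r : ℕ) : Metric.ball T (1 / ((r : ℝ) + 1)) ⊆ T.cyl r := by
  intro T' h
  obtain ⟨r', hr', hlt, hb⟩ := exists_of_dist_lt (Metric.mem_ball.1 h)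
  have hr0 : (0 : ℝ) < r' := by exact_mod_cast hr'
  have h1 : (r : ℝ) + 1 < r' := (one_div_lt_one_div hr0 (by positivity)).1 hlt
  have h2 : r + 1 < r' := by exact_mod_cast h1
  exact fun s hs => ball_eq_iff.1 hb s (by omega)

theorem isOpen_cyl (T : PlanarTree) (r : ℕ) : IsOpen (T.cyl r) := by
  rw [Metric.isOpen_iff]
  intro T' h
  refine ⟨1 / ((r : ℝ) + 1), by positivity, ?_⟩
  rw [← cyl_eq_of_mem h]
  exact ball_subset_cyl T' r

theorem measurableSet_cyl (T : PlanarTree) (r : ℕ) : MeasurableSet (T.cyl r) :=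
  (isOpen_cyl T r).measurableSet

theorem exists_cyl_subset {U : Set PlanarTree} (hU : IsOpen U) {T : PlanarTree} (hT : T ∈ U) :
    ∃ r, T.cyl (r + 1) ⊆ U := by
  obtain ⟨ε, hε, h⟩ := Metric.isOpen_iff.1 hU T hT
  obtain ⟨n, hn⟩ := exists_nat_one_div_lt hε
  refine ⟨n, fun T' hT' => h ?_⟩
  rw [Metric.mem_ball]
  refine (dist_le_of_ball_eq (r := n + 1) (by omega) (ball_eq_iff.2 hT')).trans_lt ?_
  exact_mod_cast hn

theorem isPiSystem_cyl : IsPiSystem {s | ∃ T : PlanarTree, ∃ r, s = T.cyl (r + 1)} := by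
  rintro _ ⟨T, r, rfl⟩ _ ⟨T', r', rfl⟩ ⟨T'', h, h'⟩
  rw [← cyl_eq_of_mem h, ← cyl_eq_of_mem h']
  rcases le_total r r' with hr | hr
  · exact ⟨T'', r', Set.inter_eq_right.2 (cyl_anti _ (by omega))⟩
  · exact ⟨T'', r, Set.inter_eq_left.2 (cyl_anti _ (by omega))⟩

theorem countable_cyl (r : ℕ) : (Set.range fun T : PlanarTree => T.cyl r).Countable := by
  have h : (Set.range fun T : PlanarTree => fun s : Fin r => T.parents s).Countable :=
    Set.to_countable _
  refine (h.image fun c => {T : PlanarTree | ∀ s : Fin r, T.parents s = c s}).mono ?_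
  rintro _ ⟨T, rfl⟩
  refine ⟨_, ⟨T, rfl⟩, ?_⟩
  ext T'
  exact ⟨fun h s hs => h ⟨s, hs⟩, fun h s => h s s.2⟩

theorem isTopologicalBasis_cyl :
    TopologicalSpace.IsTopologicalBasis {s | ∃ T : PlanarTree, ∃ r, s = T.cyl (r + 1)} := by
  refine TopologicalSpace.isTopologicalBasis_of_isOpen_of_nhds ?_ ?_
  · rintro _ ⟨T, r, rfl⟩
    exact isOpen_cyl T _
  · intro T U hT hU
    obtain ⟨r, hr⟩ := exists_cyl_subset hU hT
    exact ⟨_, ⟨T, r, rfl⟩, mem_cyl_self T _, hr⟩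

theorem countable_setOf_cyl : {s | ∃ T : PlanarTree, ∃ r, s = T.cyl (r + 1)}.Countable := by
  refine (Set.countable_iUnion fun r => countable_cyl (r + 1)).mono ?_
  rintro _ ⟨T, r, rfl⟩
  exact Set.mem_iUnion.2 ⟨r, T, rfl⟩

instance : SecondCountableTopology PlanarTree :=
  isTopologicalBasis_cyl.secondCountableTopology countable_setOf_cyl

theorem borel_eq_generateFrom_cyl : (inferInstance : MeasurableSpace PlanarTree) =
    MeasurableSpace.generateFrom {s | ∃ T : PlanarTree, ∃ r, s = T.cyl (r + 1)} :=
  isTopologicalBasis_cyl.borel_eq_generateFrom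

/-! ### Extending a tree by one generation -/

/-- The tree which agrees with `T` up to height `r + 1` and has one more generation. -/
def extend (T : PlanarTree) (r : ℕ) (ℓ : ChildList (T.width (r + 1))) : PlanarTree where
  parents s := if s ≤ r then T.parents s else if s = r + 1 then ℓ.1 else []
  parents_zero := by simp [T.parents_zero]
  parents_mono s := by
    split_ifs
    · exact T.parents_mono s
    · exact ℓ.2.1
    · exact List.Pairwise.nil
  parents_lt s p hp := by
    rcases lt_trichotomy s r with h | rfl | h
    · rw [if_pos (by omega)] at hp
      rw [if_pos (by omega)]
      exact T.parents_lt s p hp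
    · rw [if_neg (by omega), if_pos rfl] at hp
      rw [if_pos le_rfl]
      exact ℓ.2.2 p hp
    · rw [if_neg (by omega), if_neg (by omega)] at hp
      simp at hp

theorem extend_parents_of_le (T : PlanarTree) {r s : ℕ} (h : s ≤ r)
    (ℓ : ChildList (T.width (r + 1))) : (T.extend r ℓ).parents s = T.parents s := if_pos h

theorem extend_parents_succ (T : PlanarTree) (r : ℕ) (ℓ : ChildList (T.width (r + 1))) :
    (T.extend r ℓ).parents (r + 1) = ℓ.1 := by simp [extend]

theorem extend_width (T : PlanarTree) (r : ℕ) (ℓ : ChildList (T.width (r + 1))) :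
    (T.extend r ℓ).width (r + 2) = ℓ.length := by
  rw [width, extend_parents_succ, ChildList.length]

/-- The generation of height `r + 2` as a list of children. -/
def child (T : PlanarTree) (r : ℕ) : ChildList (T.width (r + 1)) :=
  ⟨T.parents (r + 1), T.parents_mono _, T.parents_lt r⟩

theorem mem_cyl_extend {T T' : PlanarTree} {r : ℕ} {ℓ : ChildList (T.width (r + 1))} :
    T' ∈ (T.extend r ℓ).cyl (r + 2) ↔ T' ∈ T.cyl (r + 1) ∧ T'.parents (r + 1) = ℓ.1 := by
  constructor
  · intro h
    refine ⟨fun s hs => ?_, ?_⟩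
    · rw [h s (by omega), extend_parents_of_le _ (by omega)]
    · rw [h (r + 1) (by omega), extend_parents_succ]
  · rintro ⟨h1, h2⟩ s hs
    rcases Nat.lt_succ_iff_lt_or_eq.1 hs with h | rfl
    · rw [h1 s h, extend_parents_of_le _ (by omega)]
    · rw [h2, extend_parents_succ]

theorem iUnion_cyl_extend (T : PlanarTree) (r : ℕ) :
    ⋃ ℓ, (T.extend r ℓ).cyl (r + 2) = T.cyl (r + 1) := by
  ext T'
  simp only [Set.mem_iUnion, mem_cyl_extend]
  constructor
  · rintro ⟨ℓ, h, -⟩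
    exact h
  · intro h
    have hw : T'.parents r = T.parents r := h r (by omega)
    refine ⟨⟨T'.parents (r + 1), T'.parents_mono _, fun p hp => ?_⟩, h, rfl⟩
    rw [width, ← hw]
    exact T'.parents_lt r p hp

theorem pairwise_disjoint_cyl_extend (T : PlanarTree) (r : ℕ) :
    Pairwise (Function.onFun Disjoint fun ℓ => (T.extend r ℓ).cyl (r + 2)) := by
  intro ℓ ℓ' h
  refine Set.disjoint_left.2 fun T' h1 h2 => h (Subtype.ext ?_)
  rw [← (mem_cyl_extend.1 h1).2, (mem_cyl_extend.1 h2).2]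

theorem measure_cyl_eq_tsum (ν : Measure PlanarTree) (T : PlanarTree) (r : ℕ) :
    ν (T.cyl (r + 1)) = ∑' ℓ, ν ((T.extend r ℓ).cyl (r + 2)) := by
  rw [← iUnion_cyl_extend, measure_iUnion (pairwise_disjoint_cyl_extend T r)
    fun ℓ => measurableSet_cyl _ _]

/-! ### Sizes and heights -/

/-- The number of edges of `T` below height `r`. -/
def vol (T : PlanarTree) (r : ℕ) : ℕ := ∑ s ∈ Finset.range r, T.width (s + 1)

/-- The edges of `T` below height `r`. -/
def edgesBelow (T : PlanarTree) (r : ℕ) : Finset (ℕ × ℕ) :=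
  ((Finset.range r).sigma fun s => Finset.range (T.width (s + 1))).map
    (Equiv.sigmaEquivProd ℕ ℕ).toEmbedding

theorem mem_edgesBelow {T : PlanarTree} {r : ℕ} {e : ℕ × ℕ} :
    e ∈ T.edgesBelow r ↔ e.1 < r ∧ e.2 < T.width (e.1 + 1) := by
  simp [edgesBelow, Finset.mem_map_equiv, Equiv.sigmaEquivProd]

theorem card_edgesBelow (T : PlanarTree) (r : ℕ) : (T.edgesBelow r).card = T.vol r := by
  simp [edgesBelow, vol]

theorem vol_le_size (T : PlanarTree) (r : ℕ) : (T.vol r : ℕ∞) ≤ T.size := by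
  rw [← card_edgesBelow, ← Set.encard_coe_eq_coe_finsetCard]
  exact Set.encard_le_encard fun e he => (mem_edgesBelow.1 he).2

theorem edges_eq_of_width_eq_zero {T : PlanarTree} {r : ℕ} (h : ∀ s, r < s → T.width s = 0) :
    T.edges = T.edgesBelow r := by
  ext e
  rw [Finset.mem_coe, mem_edgesBelow]
  refine ⟨fun he => ⟨?_, he⟩, fun he => he.2⟩
  by_contra! hle
  have : e.2 < T.width (e.1 + 1) := he
  rw [h _ (by omega)] at this
  omega

theorem size_eq_vol {T : PlanarTree} {r : ℕ} (h : ∀ s, r < s → T.width s = 0) :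
    T.size = T.vol r := by
  rw [size, edges_eq_of_width_eq_zero h, Set.encard_coe_eq_coe_finsetCard, card_edgesBelow]

theorem width_ball (T : PlanarTree) {r : ℕ} (hr : 1 ≤ r) (s : ℕ) :
    (T.ball r).width s = if s ≤ r then T.width s else 0 := by
  cases s with
  | zero => simp [width]
  | succ s =>
    have : (s < r ∨ s = 0) ↔ s + 1 ≤ r := by omega
    simp only [width, ball, this]
    split_ifs <;> rfl

theorem ballVolume_eq_vol (T : PlanarTree) {r : ℕ} (hr : 1 ≤ r) : T.ballVolume r = T.vol r := by
  rw [ballVolume, edges_eq_of_width_eq_zero (r := r) (fun s hs => by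
    rw [width_ball T hr, if_neg (by omega)]), Set.ncard_coe_finset, card_edgesBelow, vol, vol]
  refine Finset.sum_congr rfl fun s hs => ?_
  rw [width_ball T hr, if_pos (Nat.succ_le_of_lt (Finset.mem_range.1 hs))]

theorem width_succ_eq_zero {T : PlanarTree} {s : ℕ} (h : T.width s = 0) : T.width (s + 1) = 0 := by
  cases s with
  | zero => simp [width] at h
  | succ s =>
    rw [width, List.length_eq_zero_iff, List.eq_nil_iff_forall_not_mem]
    intro p hp
    have := T.parents_lt s p hp
    rw [width] at h
    omega

theorem width_eq_zero_of_le {T : PlanarTree} {s t : ℕ} (h : T.width s = 0) (hst : s ≤ t) :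
    T.width t = 0 := by
  induction t, hst using Nat.le_induction with
  | base => exact h
  | succ t _ ih => exact width_succ_eq_zero ih

theorem height_eq {T : PlanarTree} {r : ℕ} (h : T.width r ≠ 0) (h' : T.width (r + 1) = 0) :
    T.height = r := by
  refine IsGreatest.csSup_eq ⟨h, fun s hs => ?_⟩
  by_contra! hlt
  exact hs (width_eq_zero_of_le h' hlt)

theorem width_congr {T T' : PlanarTree} {r s : ℕ} (h : T' ∈ T.cyl r) (hs : s ≤ r) :
    T'.width s = T.width s := by
  cases s with
  | zero => rfl
  | succ s => rw [width, width, h s hs]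

theorem vol_congr {T T' : PlanarTree} {r s : ℕ} (h : T' ∈ T.cyl r) (hs : s ≤ r) :
    T'.vol s = T.vol s :=
  Finset.sum_congr rfl fun i hi => width_congr h (by have := Finset.mem_range.1 hi; omega)

theorem extend_mem_cyl (T : PlanarTree) (r : ℕ) (ℓ : ChildList (T.width (r + 1))) :
    T.extend r ℓ ∈ T.cyl (r + 1) :=
  fun _ hs => extend_parents_of_le T (by omega) ℓ

theorem vol_extend (T : PlanarTree) (r : ℕ) (ℓ : ChildList (T.width (r + 1))) :
    (T.extend r ℓ).vol (r + 2) = T.vol (r + 1) + ℓ.length := by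
  rw [vol, Finset.sum_range_succ, extend_width]
  congr 1
  exact vol_congr (extend_mem_cyl T r ℓ) le_rfl

theorem cyl_eq_singleton {T : PlanarTree} {r : ℕ} (h : T.width r = 0) : T.cyl r = {T} := by
  ext T'
  rw [Set.mem_singleton_iff]
  refine ⟨fun hT => ?_, fun h => h ▸ mem_cyl_self _ _⟩
  have h' : T'.width r = 0 := (width_congr hT le_rfl).trans h
  ext1
  funext s
  by_cases hs : s < r
  · exact hT s hs
  · have h1 : T.width (s + 1) = 0 := width_eq_zero_of_le h (by omega)
    have h2 : T'.width (s + 1) = 0 := width_eq_zero_of_le h' (by omega)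
    rw [width, List.length_eq_zero_iff] at h1 h2
    rw [h1, h2]

/-! ### The weight of a cylinder -/

/-- The finite size measure without normalization. -/
noncomputable def weightMeasure (μ : ℝ) (N : ℕ) : Measure PlanarTree :=
  Measure.sum fun T : treesOfSize N => weight μ T • Measure.dirac T.1

theorem weightMeasure_apply (μ : ℝ) (N : ℕ) {A : Set PlanarTree} (hA : MeasurableSet A) :
    weightMeasure μ N A = ∑' T : treesOfSize N, weight μ T * A.indicator 1 T.1 := by
  rw [weightMeasure, Measure.sum_apply _ hA]
  refine tsum_congr fun T => ?_
  rw [Measure.smul_apply, Measure.dirac_apply' _ hA, smul_eq_mul]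

theorem weightMeasure_univ (μ : ℝ) (N : ℕ) :
    weightMeasure μ N Set.univ = partitionFunction μ N := by
  rw [weightMeasure_apply μ N MeasurableSet.univ, partitionFunction]
  simp

theorem finiteSizeMeasure_apply (μ : ℝ) (N : ℕ) {A : Set PlanarTree} (hA : MeasurableSet A) :
    finiteSizeMeasure μ N A = weightMeasure μ N A / partitionFunction μ N := by
  rw [weightMeasure_apply μ N hA, finiteSizeMeasure, Measure.sum_apply _ hA, div_eq_mul_inv,
    ← ENNReal.tsum_mul_right]
  refine tsum_congr fun T => ?_
  rw [Measure.smul_apply, Measure.dirac_apply' _ hA, smul_eq_mul, div_eq_mul_inv]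
  ring

theorem weightMeasure_cyl_of_lt {μ : ℝ} {N r : ℕ} {T : PlanarTree} (h : N < T.vol r) :
    weightMeasure μ N (T.cyl r) = 0 := by
  rw [weightMeasure_apply μ N (measurableSet_cyl T r), ENNReal.tsum_eq_zero]
  rintro ⟨T', hT'⟩
  rw [Set.indicator_of_notMem, mul_zero]
  intro hmem
  have h1 := vol_le_size T' r
  rw [vol_congr hmem le_rfl, show T'.size = N from hT', Nat.cast_le] at h1
  omega

theorem weightMeasure_singleton (μ : ℝ) (N : ℕ) (T : PlanarTree) :
    weightMeasure μ N {T} = if T.size = N then weight μ T else 0 := by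
  rw [weightMeasure_apply μ N (measurableSet_singleton T)]
  split_ifs with h
  · rw [tsum_eq_single ⟨T, h⟩]
    · simp
    · intro T' hT'
      rw [Set.indicator_of_notMem, mul_zero]
      exact fun h' => hT' (Subtype.ext h')
  · rw [ENNReal.tsum_eq_zero]
    rintro ⟨T', hT'⟩
    rw [Set.indicator_of_notMem, mul_zero]
    rintro rfl
    exact h hT'

theorem weight_eq (μ : ℝ) (T : PlanarTree) :
    weight μ T = ENNReal.ofReal (Real.exp (-μ)) ^ T.height := by
  rw [weight, ← ENNReal.ofReal_pow (Real.exp_pos _).le, ← Real.exp_nat_mul]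
  congr 2
  ring

theorem weightMeasure_cyl_extend_empty {μ : ℝ} {N r : ℕ} {T : PlanarTree}
    (h : T.width (r + 1) ≠ 0) :
    weightMeasure μ N ((T.extend r (ChildList.empty _)).cyl (r + 2)) =
      if T.vol (r + 1) = N then ENNReal.ofReal (Real.exp (-μ)) ^ (r + 1) else 0 := by
  have hw : (T.extend r (ChildList.empty _)).width (r + 2) = 0 := by
    rw [extend_width]; rfl
  have hs : (T.extend r (ChildList.empty _)).size = T.vol (r + 1) := by
    rw [size_eq_vol (r := r + 2) fun s hs => width_eq_zero_of_le hw hs.le, vol_extend]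
    simp [ChildList.length, ChildList.empty]
  rw [cyl_eq_singleton hw, weightMeasure_singleton, hs, weight_eq, height_eq (r := r + 1) _ hw]
  · simp only [Nat.cast_inj]
  · rwa [width_congr (extend_mem_cyl T r _) le_rfl]

/-- Splitting the cylinder by its next generation reproduces the recursion `extWeight_eq`; the
induction is on the number `n` of edges still to be placed. -/
theorem weightMeasure_cyl (μ : ℝ) (N n : ℕ) : ∀ (T : PlanarTree) (r : ℕ), T.width (r + 1) ≠ 0 →
    T.vol (r + 1) + n = N → weightMeasure μ N (T.cyl (r + 1)) =
      ENNReal.ofReal (Real.exp (-μ)) ^ (r + 1) *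
        extWeight (ENNReal.ofReal (Real.exp (-μ))) (T.width (r + 1)) n := by
  induction n using Nat.strong_induction_on with
  | _ n ih =>
  intro T r hw hN
  set a := ENNReal.ofReal (Real.exp (-μ)) with ha
  -- An empty next generation ends the tree, which needs `n = 0`; more than `n` children exceed the
  -- size.
  set φ : ℕ → ℝ≥0∞ := fun L => if L = 0 then (if n = 0 then a ^ (r + 1) else 0) else
    if L ≤ n then a ^ (r + 2) * extWeight a L (n - L) else 0 with hφ
  have key : ∀ ℓ : ChildList (T.width (r + 1)),
      weightMeasure μ N ((T.extend r ℓ).cyl (r + 2)) = φ ℓ.length := by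
    intro ℓ
    simp only [hφ]
    by_cases h0 : ℓ.length = 0
    · rw [if_pos h0, ChildList.length_eq_zero.1 h0, weightMeasure_cyl_extend_empty hw]
      have : T.vol (r + 1) = N ↔ n = 0 := by omega
      simp only [this, ha]
    · rw [if_neg h0]
      split_ifs with hn
      · rw [ih (n - ℓ.length) (by omega) _ (r + 1) (by rwa [extend_width])
          (by rw [vol_extend]; omega), extend_width]
      · exact weightMeasure_cyl_of_lt (by rw [vol_extend]; omega)
  rw [measure_cyl_eq_tsum]
  simp_rw [key]
  rw [tsum_childList, tsum_eq_sum (s := Finset.range (n + 1))]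
  · rw [extWeight_eq, Finset.Nat.sum_antidiagonal_eq_sum_range_succ_mk, Finset.sum_range_succ',
      Finset.sum_range_succ']
    simp only [hφ]
    simp only [Nat.add_eq_zero_iff, one_ne_zero, and_false, if_false, if_true,
      Nat.multichoose_zero_right, Nat.cast_one, one_mul, add_zero]
    rw [mul_add, add_comm]
    congr 1
    · split_ifs <;> simp
    · rw [← mul_assoc, ← pow_succ, Finset.mul_sum]
      refine Finset.sum_congr rfl fun L hL => ?_
      rw [if_pos (by have := Finset.mem_range.1 hL; omega)]
      ring
  · intro L hL
    have : n < L := by simpa using hL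
    simp only [hφ]
    rw [if_neg (by omega), if_neg (by omega), mul_zero]

/-! ### The law of the next generation -/

/-- The harmonic function `K (1 + 1 / a) ^ (K - 1)` of the width process. -/
noncomputable def harm (a : ℝ) (K : ℕ) : ℝ := K * (1 + a⁻¹) ^ (K - 1)

/-- The probability that the next generation is a given list of `L` children of `K` vertices. -/
noncomputable def childProb (a : ℝ) (K L : ℕ) : ℝ :=
  a * (a / (1 + a) ^ 2) ^ L * harm a L / harm a K

theorem harm_nonneg {a : ℝ} (ha : 0 < a) (K : ℕ) : 0 ≤ harm a K := by
  unfold harm; positivity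

theorem harm_pos {a : ℝ} (ha : 0 < a) {K : ℕ} (hK : K ≠ 0) : 0 < harm a K := by
  have : 0 < K := Nat.pos_of_ne_zero hK
  unfold harm; positivity

theorem childProb_nonneg {a : ℝ} (ha : 0 < a) (K L : ℕ) : 0 ≤ childProb a K L :=
  div_nonneg (mul_nonneg (by positivity) (harm_nonneg ha L)) (harm_nonneg ha K)

theorem hasSum_choose_mul_pow {a : ℝ} (ha : 0 < a) (k : ℕ) :
    HasSum (fun n => ((n + k).choose k : ℝ) * (1 + a)⁻¹ ^ n) ((1 + a⁻¹) ^ (k + 1)) := by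
  have h1 : ‖(1 + a)⁻¹‖ < 1 := by
    rw [Real.norm_of_nonneg (by positivity)]
    exact inv_lt_one_of_one_lt₀ (by linarith)
  have h := hasSum_choose_mul_geometric_of_norm_lt_one k h1
  rw [one_div, ← inv_pow] at h
  have he : 1 - (1 + a)⁻¹ = a / (1 + a) := by field_simp; ring
  have he' : (a / (1 + a))⁻¹ = 1 + a⁻¹ := by field_simp; ring
  rwa [he, he'] at h

/-- Harmonicity of `harm`. Since `L * multichoose K L = K * choose (L + K - 1) K`, the sum is a
negative binomial series of ratio `1 / (1 + a)`; the term `L = 0` vanishes. -/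
theorem hasSum_childProb {a : ℝ} (ha : 0 < a) {K : ℕ} (hK : K ≠ 0) :
    HasSum (fun L => (K.multichoose L : ℝ) * childProb a K L) 1 := by
  obtain ⟨k, rfl⟩ := Nat.exists_eq_succ_of_ne_zero hK
  rw [Nat.succ_eq_add_one]
  rw [← hasSum_nat_add_iff' 1]
  have h := (hasSum_choose_mul_pow ha (k + 1)).mul_left
    (a * (a / (1 + a) ^ 2) * (k + 1) / harm a (k + 1))
  have hsum : a * (a / (1 + a) ^ 2) * (k + 1) / harm a (k + 1) * (1 + a⁻¹) ^ (k + 1 + 1) = 1 := by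
    have : (0 : ℝ) < 1 + a⁻¹ := by positivity
    rw [harm, Nat.add_sub_cancel, pow_add, pow_succ (1 + a⁻¹) k]
    push_cast
    field_simp
    ring
  rw [hsum] at h
  simp only [Finset.range_one, Finset.sum_singleton]
  rw [show childProb a (k + 1) 0 = 0 by simp [childProb, harm], mul_zero, sub_zero]
  refine h.congr_fun fun j => ?_
  have hc : ((k + 1).multichoose (j + 1) : ℝ) * (j + 1) = (k + 1) * ((j + (k + 1)).choose (k + 1)) := by
    rw [Nat.multichoose_eq, show k + 1 + (j + 1) - 1 = (k + j) + 1 by omega]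
    have h1 := Nat.add_one_mul_choose_eq (k + j) j
    have h2 := Nat.add_one_mul_choose_eq (j + k) k
    rw [Nat.choose_symm_add.symm, add_comm k j] at h1
    rw [add_comm k j, ← add_assoc]
    have h3 : (j + k + 1).choose (j + 1) * (j + 1) = (k + 1) * (j + k + 1).choose (k + 1) := by
      rw [← h1, mul_comm (k + 1), ← h2]
    exact_mod_cast h3
  have hX : a / (1 + a) ^ 2 * (1 + a⁻¹) = (1 + a)⁻¹ := by field_simp; ring
  rw [childProb, harm, Nat.add_sub_cancel, ← hX, mul_pow, pow_succ (a / (1 + a) ^ 2)]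
  push_cast
  linear_combination a * (a / (1 + a) ^ 2) ^ j * (a / (1 + a) ^ 2) * (1 + a⁻¹) ^ j /
    harm a (k + 1) * hc

/-- The measure with weights `n a⁻¹ ^ (n - 1)` is invariant under the width process. -/
theorem hasSum_stationary {a : ℝ} (ha : 0 < a) (L : ℕ) :
    HasSum (fun k : ℕ => ((k + 1 : ℕ) : ℝ) * a⁻¹ ^ k *
      (((k + 1).multichoose L : ℝ) * childProb a (k + 1) L)) (L * a⁻¹ ^ (L - 1)) := by
  have h := (hasSum_choose_mul_pow ha L).mul_left (a * (a / (1 + a) ^ 2) ^ L * harm a L)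
  have hY : (0 : ℝ) < 1 + a⁻¹ := by positivity
  have hsum : a * (a / (1 + a) ^ 2) ^ L * harm a L * (1 + a⁻¹) ^ (L + 1) = L * a⁻¹ ^ (L - 1) := by
    cases L with
    | zero => simp [harm]
    | succ j =>
      have : a / (1 + a) ^ 2 * (1 + a⁻¹) ^ 2 = a⁻¹ := by field_simp; ring
      have hpow : a⁻¹ ^ j = (a / (1 + a) ^ 2) ^ j * (1 + a⁻¹) ^ (2 * j) := by
        rw [pow_mul, ← mul_pow, this]
      rw [harm, Nat.add_sub_cancel, hpow]
      have h2 : a * (a / (1 + a) ^ 2 * (1 + a⁻¹) ^ 2) = 1 := by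
        rw [this, mul_inv_cancel₀ ha.ne']
      linear_combination ((j + 1 : ℕ) : ℝ) * (a / (1 + a) ^ 2) ^ j * (1 + a⁻¹) ^ (2 * j) * h2
  rw [hsum] at h
  refine h.congr_fun fun k => ?_
  have hX : a⁻¹ = (1 + a)⁻¹ * (1 + a⁻¹) := by field_simp; ring
  rw [childProb, harm, harm, Nat.add_sub_cancel, Nat.multichoose_eq,
    show k + 1 + L - 1 = k + L by omega]
  have hpow : a⁻¹ ^ k = (1 + a)⁻¹ ^ k * (1 + a⁻¹) ^ k := by rw [← mul_pow, ← hX]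
  rw [hpow]
  have hk : ((k + 1 : ℕ) : ℝ) ≠ 0 := by positivity
  field_simp

theorem ennreal_tsum_childProb {a : ℝ} (ha : 0 < a) {K : ℕ} (hK : K ≠ 0) :
    ∑' ℓ : ChildList K, ENNReal.ofReal (childProb a K ℓ.length) = 1 := by
  have h := hasSum_childProb ha hK
  rw [tsum_childList K fun L => ENNReal.ofReal (childProb a K L), ← ENNReal.ofReal_one,
    ← h.tsum_eq, ENNReal.ofReal_tsum_of_nonneg
      (fun L => mul_nonneg (by positivity) (childProb_nonneg ha K L)) h.summable]
  refine tsum_congr fun L => ?_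
  rw [ENNReal.ofReal_mul (by positivity), ENNReal.ofReal_natCast]

/-- The law of the generation following a generation of `K` vertices. -/
noncomputable def childLaw (a : ℝ) (K : ℕ) : Measure (ChildList K) :=
  if K = 0 then Measure.dirac (ChildList.empty K) else
    Measure.sum fun ℓ : ChildList K =>
      ENNReal.ofReal (childProb a K ℓ.length) • Measure.dirac ℓ

theorem isProbabilityMeasure_childLaw {a : ℝ} (ha : 0 < a) (K : ℕ) :
    IsProbabilityMeasure (childLaw a K) := by
  rw [childLaw]
  split_ifs with hK
  · infer_instance
  · constructor
    rw [Measure.sum_apply _ MeasurableSet.univ]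
    simpa using ennreal_tsum_childProb ha hK

theorem childLaw_singleton {a : ℝ} {K : ℕ} (hK : K ≠ 0) (ℓ : ChildList K) :
    childLaw a K {ℓ} = ENNReal.ofReal (childProb a K ℓ.length) := by
  rw [childLaw, if_neg hK, Measure.sum_apply _ (MeasurableSet.singleton ℓ), tsum_eq_single ℓ]
  · simp
  · intro ℓ' h
    simp [h]

/-! ### The limit measure -/

/-- The parent lists of the tree that is built from given choices of all generations. -/
def buildParents (u : (i : ℕ × ℕ) → ChildList i.2) : ℕ → List ℕ
  | 0 => [0]
  | r + 1 => (u (r, (buildParents u r).length)).1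

/-- The tree whose generation of height `r + 2` is `u (r, K)` if there are `K` vertices of height
`r + 1`. -/
def buildTree (u : (i : ℕ × ℕ) → ChildList i.2) : PlanarTree where
  parents := buildParents u
  parents_zero := rfl
  parents_mono r := by
    cases r with
    | zero => exact List.pairwise_singleton _ _
    | succ r => exact (u _).2.1
  parents_lt r := (u (r, (buildParents u r).length)).2.2

/-- The local limit: the law of a tree whose generations are chosen successively according to
`childLaw`. -/
noncomputable def limitMeasure (a : ℝ) : Measure PlanarTree :=
  (Measure.infinitePi fun i : ℕ × ℕ => childLaw a i.2).map buildTree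

/-- The choices in the generations below height `r + 1` that are made by `T`. -/
def choiceIndices (T : PlanarTree) (r : ℕ) : Finset (ℕ × ℕ) :=
  (Finset.range r).map ⟨fun s => (s, T.width (s + 1)), fun _ _ h => (Prod.ext_iff.1 h).1⟩

/-- Choices are made independently for every pair of height and width, but a cylinder constrains
only the finitely many pairs visited by `T`, so its measure is a product. -/
theorem preimage_cyl (T : PlanarTree) (r : ℕ) : buildTree ⁻¹' T.cyl (r + 1) =
    Set.pi (T.choiceIndices r) fun i : ℕ × ℕ =>
      {ℓ : ChildList i.2 | ℓ.1 = T.parents (i.1 + 1)} := by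
  ext u
  simp only [Set.mem_preimage, Set.mem_pi, choiceIndices, Finset.coe_map, Set.mem_image,
    Finset.coe_range, Set.mem_Iio, Set.mem_ofPred_eq]
  constructor
  · rintro h _ ⟨s, hs, rfl⟩
    have h1 : buildParents u (s + 1) = T.parents (s + 1) := h (s + 1) (by omega)
    have h2 : buildParents u s = T.parents s := h s (by omega)
    rw [buildParents, h2] at h1
    exact h1
  · intro h s
    induction s with
    | zero => exact fun _ => T.parents_zero.symm
    | succ s ih =>
      intro hs
      have h1 := h _ ⟨s, by omega, rfl⟩
      have h2 : buildParents u s = T.parents s := ih (by omega)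
      change buildParents u (s + 1) = _
      rw [buildParents, h2]
      exact h1

theorem measurable_buildTree : Measurable buildTree := by
  refine Measurable.mono (measurable_generateFrom ?_) le_rfl borel_eq_generateFrom_cyl.le
  rintro _ ⟨T, r, rfl⟩
  rw [preimage_cyl]
  exact MeasurableSet.pi (Finset.countable_toSet _) fun i _ => MeasurableSet.of_discrete

theorem isProbabilityMeasure_limitMeasure {a : ℝ} (ha : 0 < a) :
    IsProbabilityMeasure (limitMeasure a) := by
  have := fun i : ℕ × ℕ => isProbabilityMeasure_childLaw ha i.2
  exact Measure.isProbabilityMeasure_map measurable_buildTree.aemeasurable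

theorem limitMeasure_cyl_eq_prod {a : ℝ} (ha : 0 < a) (T : PlanarTree) (r : ℕ) :
    limitMeasure a (T.cyl (r + 1)) =
    ∏ s ∈ Finset.range r, childLaw a (T.width (s + 1)) {T.child s} := by
  have := fun i : ℕ × ℕ => isProbabilityMeasure_childLaw ha i.2
  rw [limitMeasure, Measure.map_apply measurable_buildTree (measurableSet_cyl T _), preimage_cyl,
    Measure.infinitePi_pi _ fun i _ => MeasurableSet.of_discrete, choiceIndices, Finset.prod_map]
  refine Finset.prod_congr rfl fun s _ => ?_
  congr 1
  ext ℓ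
  exact ⟨fun h => Subtype.ext h, fun h => congrArg Subtype.val h⟩

theorem limitMeasure_cyl_succ {a : ℝ} (ha : 0 < a) (T : PlanarTree) (r : ℕ) :
    limitMeasure a (T.cyl (r + 2)) =
    limitMeasure a (T.cyl (r + 1)) * childLaw a (T.width (r + 1)) {T.child r} := by
  rw [limitMeasure_cyl_eq_prod ha, limitMeasure_cyl_eq_prod ha, Finset.prod_range_succ]

/-- The ratios of `harm` telescope along the generations. After extinction both sides vanish because
`harm a 0 = 0`. -/
theorem limitMeasure_cyl {a : ℝ} (ha : 0 < a) (T : PlanarTree) (r : ℕ) :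
    limitMeasure a (T.cyl (r + 1)) =
    ENNReal.ofReal (a ^ r * (a / (1 + a) ^ 2) ^ T.vol (r + 1) * harm a (T.width (r + 1)) /
      (a / (1 + a) ^ 2)) := by
  have hg : 0 < a / (1 + a) ^ 2 := by positivity
  induction r with
  | zero =>
    have := isProbabilityMeasure_limitMeasure ha
    have hw : T.width 1 = 1 := by rw [width, T.parents_zero]; rfl
    rw [cyl_one, measure_univ]
    simp [vol, hw, harm, div_self hg.ne']
  | succ r ih =>
    rw [limitMeasure_cyl_succ ha, ih]
    by_cases hw : T.width (r + 1) = 0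
    · have h1 : ∀ x y : ℝ, ENNReal.ofReal (x * harm a 0 / y) = 0 := by simp [harm]
      have h2 : T.width (r + 1 + 1) = 0 := width_succ_eq_zero hw
      rw [congrArg (harm a) hw, congrArg (harm a) h2, h1, h1, zero_mul]
    · rw [childLaw_singleton hw, ← ENNReal.ofReal_mul]
      · congr 1
        have h1 : (T.child r).length = T.width (r + 2) := rfl
        have h2 : T.vol (r + 2) = T.vol (r + 1) + T.width (r + 2) := Finset.sum_range_succ _ _
        have h3 := (harm_pos ha hw).ne'
        rw [h1, childProb, show T.vol (r + 1 + 1) = T.vol (r + 1) + T.width (r + 2) from h2,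
          pow_add, pow_add, pow_one]
        generalize a / (1 + a) ^ 2 = g at *
        field_simp
      · exact div_nonneg (mul_nonneg (by positivity) (harm_nonneg ha _)) hg.le

/-! ### Weak convergence -/

instance : Inhabited PlanarTree := ⟨buildTree fun i => ChildList.empty i.2⟩

theorem extWeight_one_ne_zero {a : ℝ} (ha : 0 < a) (n : ℕ) :
    extWeight (ENNReal.ofReal a) 1 n ≠ 0 := by
  induction n with
  | zero => rw [extWeight_eq]; simp
  | succ n ih =>
    rw [extWeight_eq]
    intro h
    rw [add_eq_zero, mul_eq_zero, Finset.sum_eq_zero_iff] at h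
    rcases h.2 with h | h
    · exact (ENNReal.ofReal_pos.2 ha).ne' h
    · have := h (1, n) (by rw [Finset.HasAntidiagonal.mem_antidiagonal]; omega)
      simp [ih] at this

theorem width_one (T : PlanarTree) : T.width 1 = 1 := by
  rw [width, T.parents_zero]; rfl

theorem vol_one (T : PlanarTree) : T.vol 1 = 1 := by
  simp [vol, width_one]

theorem partitionFunction_succ (μ : ℝ) (N : ℕ) : partitionFunction μ (N + 1) =
    ENNReal.ofReal (Real.exp (-μ)) * extWeight (ENNReal.ofReal (Real.exp (-μ))) 1 N := by
  have h := weightMeasure_cyl μ (N + 1) N default 0 (by simp [width_one])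
    (by rw [zero_add, vol_one, add_comm])
  rwa [zero_add, cyl_one, weightMeasure_univ, width_one, pow_one] at h

theorem isProbabilityMeasure_finiteSizeMeasure {μ : ℝ} (hμ : μ < 0) (N : ℕ) :
    IsProbabilityMeasure (finiteSizeMeasure μ (N + 1)) := by
  have ha : 1 < Real.exp (-μ) := Real.one_lt_exp_iff.2 (by linarith)
  constructor
  rw [finiteSizeMeasure_apply μ _ MeasurableSet.univ, weightMeasure_univ, partitionFunction_succ]
  refine ENNReal.div_self (mul_ne_zero (by simp [Real.exp_pos]) (extWeight_one_ne_zero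
    (by linarith) N)) (ENNReal.mul_ne_top ENNReal.ofReal_ne_top (extWeight_ne_top ha one_ne_zero N))

theorem poleConst_pos {a : ℝ} (ha : 1 < a) : 0 < poleConst a := by
  have h0 : 0 < a⁻¹ := by positivity
  have h1 : 0 < 1 - a⁻¹ := sub_pos.2 (inv_lt_one_of_one_lt₀ ha)
  unfold poleConst
  positivity

theorem tendsto_extWeight_ratio {a : ℝ} (ha : 1 < a) {K : ℕ} (hK : K ≠ 0) (v : ℕ) :
    Tendsto (fun n => (extWeight (ENNReal.ofReal a) K n).toReal /
      (extWeight (ENNReal.ofReal a) 1 (n + v)).toReal) atTop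
      (𝓝 (harm a K * (a / (1 + a) ^ 2) ^ v)) := by
  have ha0 : 0 < a := by linarith
  have hg : 0 < a / (1 + a) ^ 2 := by positivity
  have hc := poleConst_pos ha
  have hY : 0 < 1 + a⁻¹ := by positivity
  have h1 := tendsto_extWeight ha hK
  have h2 := (tendsto_extWeight ha one_ne_zero).comp (tendsto_add_atTop_nat v)
  have h3 := (h1.div h2 (by positivity)).mul_const ((a / (1 + a) ^ 2) ^ v)
  have hlim : K * (1 + a⁻¹) ^ K * poleConst a / ((1 : ℕ) * (1 + a⁻¹) ^ 1 * poleConst a) =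
      harm a K := by
    obtain ⟨k, rfl⟩ := Nat.exists_eq_succ_of_ne_zero hK
    rw [harm, Nat.succ_eq_add_one, Nat.add_sub_cancel, pow_succ]
    field_simp
    simp
  rw [hlim] at h3
  refine h3.congr fun n => ?_
  simp only [Function.comp_apply, Pi.div_apply]
  rw [show n + v + 1 = n + 1 + v by omega, pow_add _ (n + 1) v]
  generalize a / (1 + a) ^ 2 = g at *
  rcases eq_or_ne (extWeight (ENNReal.ofReal a) 1 (n + v)).toReal 0 with h0 | h0
  · simp [h0]
  · field_simp

theorem tendsto_finiteSizeMeasure_cyl {μ : ℝ} (hμ : μ < 0) (T : PlanarTree) (r : ℕ) :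
    Tendsto (fun N => finiteSizeMeasure μ (N + 1) (T.cyl (r + 1))) atTop
      (𝓝 (limitMeasure (Real.exp (-μ)) (T.cyl (r + 1)))) := by
  have ha : 1 < Real.exp (-μ) := Real.one_lt_exp_iff.2 (by linarith)
  have hne := fun n => extWeight_one_ne_zero (a := Real.exp (-μ)) (by linarith) n
  have hpf := partitionFunction_succ μ
  have hcyl := fun N n => weightMeasure_cyl μ N n T r
  generalize Real.exp (-μ) = a at *
  have ha0 : 0 < a := by linarith
  have hg : 0 < a / (1 + a) ^ 2 := by positivity
  rw [limitMeasure_cyl ha0]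
  by_cases hw : T.width (r + 1) = 0
  · rw [hw, show harm a 0 = 0 by simp [harm], mul_zero, zero_div, ENNReal.ofReal_zero]
    refine tendsto_const_nhds.congr' ?_
    filter_upwards [eventually_ge_atTop (T.vol (r + 1))] with N hN
    rw [finiteSizeMeasure_apply μ _ (measurableSet_cyl _ _), cyl_eq_singleton hw,
      weightMeasure_singleton, size_eq_vol fun s hs => width_eq_zero_of_le hw (le_of_lt hs),
      if_neg, ENNReal.zero_div]
    rw [Nat.cast_inj]
    omega
  · obtain ⟨v, hv⟩ : ∃ v, T.vol (r + 1) = v + 1 := by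
      refine Nat.exists_eq_add_one.2 ?_
      have : T.vol 1 ≤ T.vol (r + 1) :=
        Finset.sum_le_sum_of_subset (Finset.range_mono (by omega))
      rw [vol_one] at this
      omega
    -- The trees of size `n + v + 1` in the cylinder have exactly `n` edges above its top level.
    rw [← tendsto_add_atTop_iff_nat v]
    have hlim := ENNReal.tendsto_ofReal ((tendsto_extWeight_ratio ha hw v).const_mul (a ^ r))
    have he : a ^ r * (harm a (T.width (r + 1)) * (a / (1 + a) ^ 2) ^ v) =
        a ^ r * (a / (1 + a) ^ 2) ^ T.vol (r + 1) * harm a (T.width (r + 1)) /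
          (a / (1 + a) ^ 2) := by
      rw [hv, pow_succ (a / (1 + a) ^ 2)]
      generalize a / (1 + a) ^ 2 = g at *
      field_simp
    rw [he] at hlim
    refine hlim.congr fun n => ?_
    have hn1 := extWeight_ne_top ha one_ne_zero (n + v)
    have hn2 := extWeight_ne_top ha hw n
    rw [finiteSizeMeasure_apply μ _ (measurableSet_cyl _ _), hpf,
      hcyl (n + v + 1) n hw (by omega)]
    have hpos : 0 < (extWeight (ENNReal.ofReal a) 1 (n + v)).toReal :=
      ENNReal.toReal_pos (hne _) hn1
    rw [← ENNReal.ofReal_toReal hn1, ← ENNReal.ofReal_toReal hn2,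
      ENNReal.toReal_ofReal ENNReal.toReal_nonneg, ENNReal.toReal_ofReal ENNReal.toReal_nonneg,
      ← ENNReal.ofReal_pow ha0.le, ← ENNReal.ofReal_mul (by positivity),
      ← ENNReal.ofReal_mul ha0.le, ← ENNReal.ofReal_div_of_pos (by positivity)]
    congr 1
    rw [pow_succ]
    field_simp

theorem isLocalLimit_limitMeasure {μ : ℝ} (hμ : μ < 0) :
    IsLocalLimit μ (limitMeasure (Real.exp (-μ))) := by
  have hP := isProbabilityMeasure_limitMeasure (Real.exp_pos (-μ))
  have hN := isProbabilityMeasure_finiteSizeMeasure hμ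
  refine ⟨hP, fun F => ?_⟩
  rw [← tendsto_add_atTop_iff_nat 1]
  have h : Tendsto (β := ProbabilityMeasure PlanarTree)
      (fun N => ⟨finiteSizeMeasure μ (N + 1), hN N⟩) atTop
      (𝓝 ⟨limitMeasure (Real.exp (-μ)), hP⟩) := by
    refine isPiSystem_cyl.tendsto_probabilityMeasure_of_tendsto_of_mem ?_ ?_ ?_
    · rintro _ ⟨T, r, rfl⟩
      exact measurableSet_cyl T _
    · intro U hU T hT
      obtain ⟨r, hr⟩ := exists_cyl_subset hU hT
      exact ⟨_, ⟨T, r, rfl⟩, (isOpen_cyl T _).mem_nhds (mem_cyl_self T _), hr⟩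
    · rintro _ ⟨T, r, rfl⟩
      exact (ENNReal.tendsto_toNNReal (measure_ne_top (limitMeasure (Real.exp (-μ))) _)).comp
        (tendsto_finiteSizeMeasure_cyl hμ T r)
  exact ProbabilityMeasure.tendsto_iff_forall_integral_tendsto.1 h F

/-! ### The law of the width -/

theorem measurable_width (s : ℕ) : Measurable fun T : PlanarTree => T.width s := by
  refine measurable_to_countable' fun L => IsOpen.measurableSet ?_
  rw [isOpen_iff_mem_nhds]
  intro T hT
  refine mem_of_superset ((isOpen_cyl T s).mem_nhds (mem_cyl_self T s)) fun T' hT' => ?_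
  exact (width_congr hT' le_rfl).trans hT

theorem measure_eq_tsum_cyl (ν : Measure PlanarTree) (r : ℕ) (A : Set PlanarTree) :
    ν A = ∑' c : Set.range fun T : PlanarTree => T.cyl r, ν (c.1 ∩ A) := by
  have hpre : ∀ T : PlanarTree, (fun T : PlanarTree => T.cyl r) ⁻¹' {T.cyl r} = T.cyl r := by
    intro T
    ext T'
    exact ⟨fun h => (h : T'.cyl r = T.cyl r) ▸ mem_cyl_self T' r, fun h => cyl_eq_of_mem h⟩
  have h := tsum_measure_preimage_singleton (μ := ν.restrict A) (countable_cyl r)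
    (f := fun T : PlanarTree => T.cyl r) (by
      rintro _ ⟨T, rfl⟩
      rw [hpre]
      exact measurableSet_cyl T r)
  rw [Set.preimage_range, Measure.restrict_apply MeasurableSet.univ, Set.univ_inter] at h
  rw [← h]
  refine tsum_congr ?_
  rintro ⟨_, T, rfl⟩
  rw [hpre, Measure.restrict_apply (measurableSet_cyl T r)]

theorem limitMeasure_cyl_extend {a : ℝ} (ha : 0 < a) (T : PlanarTree) {r : ℕ}
    (hw : T.width (r + 1) ≠ 0) (ℓ : ChildList (T.width (r + 1))) :
    limitMeasure a ((T.extend r ℓ).cyl (r + 2)) =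
      limitMeasure a (T.cyl (r + 1)) * ENNReal.ofReal (childProb a (T.width (r + 1)) ℓ.length) := by
  have hT := extend_mem_cyl T r ℓ
  have hw' := width_congr hT le_rfl
  have hl : ((T.extend r ℓ).child r).length = ℓ.length := extend_width T r ℓ
  rw [limitMeasure_cyl_succ ha, cyl_eq_of_mem hT, childLaw_singleton (by rwa [hw']), hl, hw']

theorem limitMeasure_cyl_inter_width {a : ℝ} (ha : 0 < a) (T : PlanarTree) {r : ℕ}
    (hw : T.width (r + 1) ≠ 0) (L : ℕ) :
    limitMeasure a (T.cyl (r + 1) ∩ {T' | T'.width (r + 2) = L}) =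
      limitMeasure a (T.cyl (r + 1)) * (((T.width (r + 1)).multichoose L : ℝ≥0∞) *
        ENNReal.ofReal (childProb a (T.width (r + 1)) L)) := by
  rw [← Measure.restrict_apply (measurableSet_cyl T _), measure_cyl_eq_tsum]
  set φ : ℕ → ℝ≥0∞ := fun L' => if L' = L then limitMeasure a (T.cyl (r + 1)) *
    ENNReal.ofReal (childProb a (T.width (r + 1)) L') else 0 with hφ
  have key : ∀ ℓ : ChildList (T.width (r + 1)),
      (limitMeasure a).restrict {T' | T'.width (r + 2) = L} ((T.extend r ℓ).cyl (r + 2)) =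
        φ ℓ.length := by
    intro ℓ
    rw [Measure.restrict_apply (measurableSet_cyl _ _)]
    simp only [hφ]
    split_ifs with h
    · rw [← limitMeasure_cyl_extend ha T hw ℓ, Set.inter_eq_left.2]
      exact fun T' hT' => ((width_congr hT' le_rfl).trans (extend_width T r ℓ)).trans h
    · rw [Set.eq_empty_of_forall_notMem (s := _ ∩ _), measure_empty]
      rintro T' ⟨hT', hL⟩
      exact h (((width_congr hT' le_rfl).trans (extend_width T r ℓ)).symm.trans hL)
  rw [tsum_congr key, tsum_childList, tsum_eq_single L fun L' hL' => by simp [hφ, hL']]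
  simp only [hφ, if_true]
  ring

/-- The Markov property of the widths: within each cylinder the transition probability depends on
its top width only. -/
theorem limitMeasure_width_inter {a : ℝ} (ha : 0 < a) (r : ℕ) {K : ℕ} (hK : K ≠ 0) (L : ℕ) :
    limitMeasure a ({T | T.width (r + 1) = K} ∩ {T | T.width (r + 2) = L}) =
      limitMeasure a {T | T.width (r + 1) = K} *
        ((K.multichoose L : ℝ≥0∞) * ENNReal.ofReal (childProb a K L)) := by
  rw [measure_eq_tsum_cyl _ (r + 1), measure_eq_tsum_cyl _ (r + 1) {T | T.width (r + 1) = K},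
    ← ENNReal.tsum_mul_right]
  refine tsum_congr ?_
  rintro ⟨_, T, rfl⟩
  beta_reduce
  by_cases h : T.width (r + 1) = K
  · have hsub : T.cyl (r + 1) ⊆ {T | T.width (r + 1) = K} :=
      fun T' hT' => (width_congr hT' le_rfl).trans h
    rw [← Set.inter_assoc, Set.inter_eq_left.2 hsub,
      limitMeasure_cyl_inter_width ha T (by rwa [h]), h]
  · have hemp : T.cyl (r + 1) ∩ {T | T.width (r + 1) = K} = ∅ := by
      refine Set.eq_empty_of_forall_notMem ?_
      rintro T' ⟨hT', hK'⟩
      exact h ((width_congr hT' le_rfl).symm.trans hK')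
    rw [← Set.inter_assoc, hemp, Set.empty_inter, measure_empty, zero_mul]

theorem limitMeasure_width_eq_zero {a : ℝ} (ha : 0 < a) (r : ℕ) :
    limitMeasure a {T | T.width r = 0} = 0 := by
  cases r with
  | zero => simp [width]
  | succ r =>
    rw [measure_eq_tsum_cyl _ (r + 1), ENNReal.tsum_eq_zero]
    rintro ⟨_, T, rfl⟩
    by_cases h : T.width (r + 1) = 0
    · refine measure_mono_null Set.inter_subset_left ?_
      beta_reduce
      rw [limitMeasure_cyl ha, h]
      simp [harm]
    · rw [Set.eq_empty_of_forall_notMem (s := _ ∩ _), measure_empty]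
      rintro T' ⟨hT', h0⟩
      exact h ((width_congr hT' le_rfl).symm.trans h0)

/-- The invariant weights need no normalization: they give mass 1 to width 1, where the chain
starts, and domination by an invariant measure persists under the transition kernel. -/
theorem limitMeasure_width_le {a : ℝ} (ha : 0 < a) (r L : ℕ) :
    limitMeasure a {T | T.width (r + 1) = L} ≤ ENNReal.ofReal (L * a⁻¹ ^ (L - 1)) := by
  induction r generalizing L with
  | zero =>
    have := isProbabilityMeasure_limitMeasure ha
    by_cases hL : L = 1
    · subst hL
      simpa using prob_le_one
    · have : {T : PlanarTree | T.width (0 + 1) = L} = ∅ := by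
        refine Set.eq_empty_of_forall_notMem fun T hT => hL ?_
        rw [← T.width_one]
        exact hT.symm
      rw [this, measure_empty]
      exact zero_le
  | succ r ih =>
    by_cases hL : L = 0
    · rw [hL, limitMeasure_width_eq_zero ha]
      exact zero_le
    have hs := hasSum_stationary ha L
    have hsplit : limitMeasure a {T | T.width (r + 1 + 1) = L} =
        ∑' K, limitMeasure a ({T | T.width (r + 1) = K} ∩ {T | T.width (r + 2) = L}) := by
      rw [← measure_iUnion]
      · rw [← Set.iUnion_inter]
        congr 1
        ext T
        simp
      · intro i j hij
        refine Set.disjoint_left.2 ?_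
        rintro T ⟨h1, -⟩ ⟨h2, -⟩
        exact hij (h1.symm.trans h2)
      · exact fun K => (measurable_width _ (measurableSet_singleton K)).inter
          (measurable_width _ (measurableSet_singleton L))
    rw [hsplit, tsum_eq_zero_add' ENNReal.summable]
    -- Extinct generations contribute nothing to `L ≠ 0`, which matches the sum over `k + 1` in
    -- `hasSum_stationary`.
    have h0 : {T : PlanarTree | T.width (r + 1) = 0} ∩ {T | T.width (r + 2) = L} = ∅ := by
      refine Set.eq_empty_of_forall_notMem ?_
      rintro T ⟨h1, h2⟩
      exact hL ((h2 : T.width (r + 2) = L).symm.trans (width_succ_eq_zero h1))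
    rw [h0, measure_empty, zero_add, ← hs.tsum_eq, ENNReal.ofReal_tsum_of_nonneg _ hs.summable]
    · refine ENNReal.tsum_le_tsum fun k => ?_
      rw [limitMeasure_width_inter ha r (Nat.succ_ne_zero k),
        ENNReal.ofReal_mul (p := ((k + 1 : ℕ) : ℝ) * a⁻¹ ^ k) (by positivity),
        ENNReal.ofReal_mul (p := ((k + 1).multichoose L : ℝ)) (by positivity),
        ENNReal.ofReal_natCast]
      gcongr
      exact ih (k + 1)
    · exact fun k => mul_nonneg (by positivity)
        (mul_nonneg (by positivity) (childProb_nonneg ha _ _))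

/-- Half of the decay `a⁻¹ ^ L = s ^ (2 L)` makes the factor `L` summable, the other half gives `s ^
m` since `L ≥ m`. -/
theorem exists_limitMeasure_le_width_le {a s : ℝ} (ha : 0 < a) (hs0 : 0 < s) (hs1 : s < 1)
    (hs : a⁻¹ = s ^ 2) : ∃ B : ℝ, 0 ≤ B ∧ ∀ r m : ℕ,
      limitMeasure a {T | m ≤ T.width (r + 1)} ≤ ENNReal.ofReal (B * s ^ m) := by
  have hsum : Summable fun L : ℕ => (L : ℝ) * s ^ L := by
    have := summable_pow_mul_geometric_of_norm_lt_one 1 (r := s)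
      (by rwa [Real.norm_of_nonneg hs0.le])
    simpa using this
  refine ⟨(∑' L : ℕ, (L : ℝ) * s ^ L) / s ^ 2, div_nonneg (tsum_nonneg fun L => by positivity)
    (by positivity), fun r m => ?_⟩
  have hpart : {T : PlanarTree | m ≤ T.width (r + 1)} ⊆
      ⋃ L : ℕ, {T | m ≤ L ∧ T.width (r + 1) = L} := fun T hT =>
    Set.mem_iUnion.2 ⟨T.width (r + 1), hT, rfl⟩
  refine (measure_mono hpart).trans ((measure_iUnion_le _).trans ?_)
  have hterm : ∀ L : ℕ, 0 ≤ (L : ℝ) * s ^ L * (s ^ m / s ^ 2) := fun L => by positivity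
  rw [show (∑' L : ℕ, (L : ℝ) * s ^ L) / s ^ 2 * s ^ m =
      (∑' L : ℕ, (L : ℝ) * s ^ L) * (s ^ m / s ^ 2) by ring, ← tsum_mul_right,
    ENNReal.ofReal_tsum_of_nonneg hterm (hsum.mul_right _)]
  refine ENNReal.tsum_le_tsum fun L => ?_
  by_cases hm : m ≤ L
  · simp only [hm, true_and]
    refine (limitMeasure_width_le ha r L).trans (ENNReal.ofReal_le_ofReal ?_)
    rcases Nat.eq_zero_or_pos L with rfl | hL
    · simp
    · obtain ⟨j, rfl⟩ := Nat.exists_eq_add_one.2 hL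
      rw [Nat.add_sub_cancel, hs, mul_assoc]
      refine mul_le_mul_of_nonneg_left ?_ (by positivity)
      rw [← mul_div_assoc, le_div_iff₀ (by positivity), ← pow_mul, ← pow_add, ← pow_add]
      exact pow_le_pow_of_le_one hs0.le hs1.le (by omega)
  · simp [hm]

/-! ### Almost sure growth -/

theorem ae_eventually_width_le {a : ℝ} (ha : 1 < a) : ∃ C : ℝ, 0 < C ∧
    ∀ᵐ T ∂limitMeasure a, ∀ᶠ r : ℕ in atTop, (T.width r : ℝ) ≤ C * Real.log r := by
  have ha0 : 0 < a := by linarith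
  have hi0 : 0 < a⁻¹ := by positivity
  have hi1 : a⁻¹ < 1 := inv_lt_one_of_one_lt₀ ha
  set s := √a⁻¹ with hs
  have hs0 : 0 < s := Real.sqrt_pos.2 hi0
  have hs1 : s < 1 := by rw [hs, Real.sqrt_lt' one_pos]; linarith
  have hs2 : a⁻¹ = s ^ 2 := (Real.sq_sqrt hi0.le).symm
  obtain ⟨B, hB, hle⟩ := exists_limitMeasure_le_width_le ha0 hs0 hs1 hs2
  have hlog : Real.log s < 0 := Real.log_neg hs0 hs1
  have hlog' := hlog.ne
  -- With this constant `s ^ (C log r) = r ^ (-2)`, which is summable, as Borel–Cantelli requires.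
  refine ⟨2 / (-Real.log s), div_pos two_pos (by linarith), ?_⟩
  set C := 2 / (-Real.log s) with hC
  have hbound : ∀ r : ℕ, limitMeasure a {T | C * Real.log (r + 1 : ℕ) < T.width (r + 1)} ≤
      ENNReal.ofReal (B * (1 / ((r + 1 : ℕ) : ℝ) ^ 2)) := by
    intro r
    have hr : (0 : ℝ) < (r + 1 : ℕ) := by positivity
    refine (measure_mono (t := {T : PlanarTree | ⌈C * Real.log (r + 1 : ℕ)⌉₊ ≤ T.width (r + 1)})
      fun T hT => Nat.ceil_le.2 (le_of_lt hT)).trans ((hle r _).trans ?_)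
    refine ENNReal.ofReal_le_ofReal (mul_le_mul_of_nonneg_left ?_ hB)
    rw [← Real.rpow_natCast]
    refine (Real.rpow_le_rpow_of_exponent_ge hs0 hs1.le (Nat.le_ceil _)).trans (le_of_eq ?_)
    rw [Real.rpow_def_of_pos hs0, show Real.log s * (C * Real.log (r + 1 : ℕ)) =
        -(2 * Real.log (r + 1 : ℕ)) by rw [hC]; field_simp, Real.exp_neg, one_div]
    congr 1
    rw [two_mul, Real.exp_add, Real.exp_log hr, sq]
  have hsum : ∑' r : ℕ, limitMeasure a {T | C * Real.log (r + 1 : ℕ) < T.width (r + 1)} ≠ ∞ := by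
    refine ne_top_of_le_ne_top ?_ (ENNReal.tsum_le_tsum hbound)
    have hsm : Summable fun r : ℕ => B * (1 / ((r + 1 : ℕ) : ℝ) ^ 2) :=
      ((summable_nat_add_iff 1).2 (Real.summable_one_div_nat_pow.2 one_lt_two)).mul_left B
    exact hsm.tsum_ofReal_ne_top
  filter_upwards [ae_eventually_notMem hsum] with T hT
  obtain ⟨n, hn⟩ := eventually_atTop.1 hT
  refine eventually_atTop.2 ⟨n + 1, fun r hr => ?_⟩
  obtain ⟨k, rfl⟩ := Nat.exists_eq_add_of_le' (show 1 ≤ r by omega)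
  exact not_lt.1 (hn k (by omega))

theorem le_vol {T : PlanarTree} (h : ∀ r, T.width r ≠ 0) (r : ℕ) : r ≤ T.vol r := by
  rw [vol]
  calc r = ∑ _s ∈ Finset.range r, 1 := by simp
    _ ≤ _ := Finset.sum_le_sum fun s _ => Nat.one_le_iff_ne_zero.2 (h _)

theorem vol_le_of_width_le {T : PlanarTree} {C : ℝ} (hC : 0 < C) {R : ℕ} (hR : 1 ≤ R)
    (h : ∀ r, R ≤ r → (T.width r : ℝ) ≤ C * Real.log r) (r : ℕ) (hr : R ≤ r) :
    (T.vol r : ℝ) ≤ T.vol R + r * (C * Real.log r) := by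
  induction r, hr using Nat.le_induction with
  | base =>
    have : 0 ≤ Real.log R := Real.log_natCast_nonneg R
    have : 0 ≤ R * (C * Real.log R) := by positivity
    linarith
  | succ r hr ih =>
    have h1 : T.vol (r + 1) = T.vol r + T.width (r + 1) := Finset.sum_range_succ _ _
    have h2 := h (r + 1) (by omega)
    have h3 : Real.log r ≤ Real.log (r + 1 : ℕ) :=
      Real.log_le_log (by exact_mod_cast (show 0 < r by omega)) (by push_cast; linarith)
    have h4 : (r : ℝ) * (C * Real.log r) ≤ r * (C * Real.log (r + 1 : ℕ)) := by gcongr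
    rw [h1, Nat.cast_add, show ((r + 1 : ℕ) : ℝ) * (C * Real.log (r + 1 : ℕ)) =
      r * (C * Real.log (r + 1 : ℕ)) + C * Real.log (r + 1 : ℕ) by push_cast; ring]
    linarith

theorem one_le_log {r : ℕ} (hr : 3 ≤ r) : 1 ≤ Real.log r := by
  have h3 : (3 : ℝ) ≤ r := by exact_mod_cast hr
  rw [Real.le_log_iff_exp_le (by linarith)]
  exact Real.exp_one_lt_three.le.trans h3

theorem exists_growth_bounds {T : PlanarTree} (h0 : ∀ r, T.width r ≠ 0) {C : ℝ} (hC : 0 < C)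
    (h : ∀ᶠ r : ℕ in atTop, (T.width r : ℝ) ≤ C * Real.log r) :
    ∃ r₀ : ℕ, ∀ r : ℕ, r₀ ≤ r →
      (1 ≤ T.width r ∧ (T.width r : ℝ) ≤ C * Real.log r) ∧
      (r ≤ T.ballVolume r ∧ (T.ballVolume r : ℝ) ≤ (C + 1) * (r * Real.log r)) := by
  obtain ⟨R, hR⟩ := eventually_atTop.1 h
  -- Beyond this height the initial volume is at most `r`, and `r ≤ r log r` because `r ≥ 3`; this
  -- accounts for the `1` in `C + 1`.
  refine ⟨max (max R 3) (T.vol (R + 1)) + 1, fun r hr => ?_⟩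
  have hr1 : R + 1 ≤ r := by omega
  have hr2 : T.vol (R + 1) ≤ r := by omega
  have hr3 : 3 ≤ r := by omega
  refine ⟨⟨Nat.one_le_iff_ne_zero.2 (h0 r), hR r (by omega)⟩, ?_⟩
  rw [ballVolume_eq_vol T (by omega)]
  refine ⟨le_vol h0 r, ?_⟩
  have h1 := vol_le_of_width_le hC (R := R + 1) (by omega) (fun r hr => hR r (by omega)) r hr1
  have h2 : (T.vol (R + 1) : ℝ) ≤ r := by exact_mod_cast hr2
  have h3 : (r : ℝ) ≤ r * Real.log r := le_mul_of_one_le_right (Nat.cast_nonneg r) (one_le_log hr3)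
  linarith

theorem hasHausdorffDim_one {T : PlanarTree} {C : ℝ} (hC : 0 < C)
    (h : ∃ r₀ : ℕ, ∀ r : ℕ, r₀ ≤ r →
      r ≤ T.ballVolume r ∧ (T.ballVolume r : ℝ) ≤ C * (r * Real.log r)) :
    T.HasHausdorffDim 1 := by
  obtain ⟨r₀, h⟩ := h
  have hlog : Tendsto (fun r : ℕ => Real.log r) atTop atTop :=
    Real.tendsto_log_atTop.comp tendsto_natCast_atTop_atTop
  have h1 : Tendsto (fun r : ℕ => Real.log C / Real.log r) atTop (𝓝 0) :=
    hlog.const_div_atTop _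
  have h2 : Tendsto (fun r : ℕ => Real.log (Real.log r) / Real.log r) atTop (𝓝 0) :=
    Real.isLittleO_log_id_atTop.tendsto_div_nhds_zero.comp hlog
  have h3 := (h1.add_const 1).add h2
  rw [zero_add, add_zero] at h3
  refine tendsto_of_tendsto_of_tendsto_of_le_of_le' tendsto_const_nhds h3 ?_ ?_
  · filter_upwards [eventually_ge_atTop (max r₀ 3)] with r hr
    have hl := one_le_log (r := r) (by omega)
    have hr0 : (0 : ℝ) < r := by exact_mod_cast (show 0 < r by omega)
    rw [le_div_iff₀ (by linarith), one_mul]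
    exact Real.log_le_log hr0 (by exact_mod_cast (h r (by omega)).1)
  · filter_upwards [eventually_ge_atTop (max r₀ 3)] with r hr
    have hl := one_le_log (r := r) (by omega)
    have hr0 : (0 : ℝ) < r := by exact_mod_cast (show 0 < r by omega)
    have hl0 : 0 < Real.log r := by linarith
    obtain ⟨hb1, hb2⟩ := h r (by omega)
    have hb0 : (0 : ℝ) < T.ballVolume r := by exact_mod_cast (show 0 < T.ballVolume r by omega)
    have := Real.log_le_log hb0 hb2
    rw [Real.log_mul hC.ne' (by positivity), Real.log_mul hr0.ne' hl0.ne'] at this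
    rw [div_add_one hl0.ne', ← add_div]
    gcongr
    linarith

end PlanarTree

/-! ### Conclusion: growth bounds and dimension of the local limit -/

theorem mainTheorem12 (μ : ℝ) (hμ : μ < 0) :
    ∃ ν : MeasureTheory.Measure PlanarTree, PlanarTree.IsLocalLimit μ ν ∧
      (∃ C₁ C₂ : ℝ, 0 < C₁ ∧ 0 < C₂ ∧
        ∀ᵐ T ∂ν, ∃ r₀ : ℕ, ∀ r : ℕ, r₀ ≤ r →
          (1 ≤ T.width r ∧ (T.width r : ℝ) ≤ C₁ * Real.log r) ∧
          (r ≤ T.ballVolume r ∧ (T.ballVolume r : ℝ) ≤ C₂ * (r * Real.log r))) ∧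
      ∀ᵐ T ∂ν, T.HasHausdorffDim 1 := by
  have ha : 1 < Real.exp (-μ) := Real.one_lt_exp_iff.2 (by linarith)
  obtain ⟨C, hC, hw⟩ := PlanarTree.ae_eventually_width_le ha
  have h0 : ∀ᵐ T ∂PlanarTree.limitMeasure (Real.exp (-μ)), ∀ r, T.width r ≠ 0 := by
    rw [ae_all_iff]
    intro r
    rw [ae_iff]
    simpa using PlanarTree.limitMeasure_width_eq_zero (Real.exp_pos (-μ)) r
  have hgrowth : ∀ᵐ T ∂PlanarTree.limitMeasure (Real.exp (-μ)), ∃ r₀ : ℕ, ∀ r : ℕ, r₀ ≤ r →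
      (1 ≤ T.width r ∧ (T.width r : ℝ) ≤ C * Real.log r) ∧
      (r ≤ T.ballVolume r ∧ (T.ballVolume r : ℝ) ≤ (C + 1) * (r * Real.log r)) := by
    filter_upwards [hw, h0] with T h1 h2
    exact PlanarTree.exists_growth_bounds h2 hC h1
  refine ⟨_, PlanarTree.isLocalLimit_limitMeasure hμ, ⟨C, C + 1, hC, by linarith, hgrowth⟩, ?_⟩
  filter_upwards [hgrowth] with T hT
  obtain ⟨r₀, h⟩ := hT
  exact PlanarTree.hasHausdorffDim_one (by linarith : 0 < C + 1) ⟨r₀, fun r hr => (h r hr).2⟩
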